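/- Let $0<\varepsilon<1/64$, let $B_\varepsilon\subset\mathbb R^2$ be the closed disc of radius $\varepsilon$ about the origin and $D_\varepsilon=\mathbb R^2\setminus B_\varepsilon$. For $k\in\mathbb N$ let $D_\varepsilon^k=D_\varepsilon\cap 2^{-k}\mathbb Z^2$, $\mathbb Z_+=\{1,2,\dots\}$ and $E^k=2^{-k}\mathbb Z_+\cup\{a_k^*\}\cup D_\varepsilon^k$, where the single point $a^*_k$ replaces both the lattice points in $B_\varepsilon$ and the origin $0$ of the half-line. Let $G^k$ be the graph on $E^k$ with the following edges: $x,y\in D^k_\varepsilon$ are adjacent if $|x-y|=2^{-k}$ and the segment $[x,y]$ does not meet $B_\varepsilon$; $x,y\in 2^{-k}\mathbb Z_+\cup\{0\}$ (with $0$ read as $a_k^*$) are adjacent if $|x-y|=2^{-k}$; and $x\in D^k_\varepsilon$ is adjacent to $a_k^*$ if some $y\in 2^{-k}\mathbb Z^2\cap B_\varepsilon$ has $|x-y|=2^{-k}$. Write $v_k(x)$ for the number of neighbours of $x$, let $d_k(x,y)$ be $2^{-k}$ times the graph distance of $x$ and $y$ in $G^k$, and let $m_k$ be the measure on $E^k$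 with $$m_k(x)=\tfrac{2^{-2k}}4v_k(x)\ (x\in D^k_\varepsilon),\qquad m_k(x)=\tfrac{2^{-k}}2v_k(x)\ (x\in 2^{-k}\mathbb Z_+),\qquad m_k(a_k^*)=\tfrac{2^{-k}}2+\tfrac{2^{-2k}}4\,(v_k(a_k^*)-1).$$ Let $(P^k_t)_{t\ge0}$ be the semigroup on $L^2(E^k,m_k)$ associated with the Dirichlet form $\mathcal E^k$ with domain $L^2(E^k,m_k)$ given by $$\mathcal E^k(f,f)=\frac18\sum_{\substack{(x,y):\,x\leftrightarrow y\\ x,y\in D^k_\varepsilon\cup\{a^*_k\}}}(f(x)-f(y))^2+\frac{2^k}4\sum_{\substack{(x,y):\,x\leftrightarrow y\\ x,y\in 2^{-k}\mathbb Z_+\cup\{a_k^*\}}}(f(x)-f(y))^2,$$ where the sums run over ordered pairs of adjacent vertices (so each edge is counted twice), and let $p_k(t,x,y)=(P^k_t\mathbf 1_{\{y\}})(x)/m_k(y)$ be its transition density with respect to $m_k$. Let $k_0\in\mathbb N$ be such that $2^{-k}<\varepsilon/4$ for all $k\ge k_0$. Then there is a constant $C_2>0$, independent of $k$, such that for all $k\ge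 k_0$, all real $\alpha_k\le 2^{k-1}$, all $0<t<\infty$ and all $x,y\in E^k$, $$p_k(t,x,y)\le C_2\left(\frac1t\vee\frac1{\sqrt t}\right)\exp\left(-\alpha_k\,d_k(x,y)+2t\alpha_k^2\right).$$ -/

import Mathlib

open MeasureTheory
open scoped ENNReal

noncomputable section

namespace VaryingDim

/-- The mesh size `2^{-k}`. -/
def mesh (k : ℕ) : ℝ := ((2 : ℝ) ^ k)⁻¹

/-- The closed disc `B_ε` of radius `ε` around the origin of the Euclidean plane. -/
def disc (ε : ℝ) : Set (EuclideanSpace ℝ (Fin 2)) := Metric.closedBall 0 ε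

/-- The point `2^{-k} z` of the planar lattice `2^{-k} ℤ²`. -/
def latticePoint (k : ℕ) (z : ℤ × ℤ) : EuclideanSpace ℝ (Fin 2) :=
  !₂[mesh k * (z.1 : ℝ), mesh k * (z.2 : ℝ)]

/-- The state space `E^k`: the point `a*_k` (which stands for all the lattice points of the
closed disc, and for the origin of the half-line), the points `2^{-k} n`, `n = 1, 2, …`, of the
half-line, and the points of `2^{-k} ℤ²` that lie outside the closed disc. -/
inductive Vertex (ε : ℝ) (k : ℕ) : Type
  | star : Vertex ε k
  | line (n : ℕ+) : Vertex ε k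
  | plane (z : ℤ × ℤ) (hz : latticePoint k z ∉ disc ε) : Vertex ε k

instance (ε : ℝ) (k : ℕ) : MeasurableSpace (Vertex ε k) := ⊤

instance (ε : ℝ) (k : ℕ) : DiscreteMeasurableSpace (Vertex ε k) := ⟨fun _ => trivial⟩

/-- The adjacency relation of `G^k`. -/
def Adj (ε : ℝ) (k : ℕ) : Vertex ε k → Vertex ε k → Prop
  | .plane z _, .plane w _ =>
      dist (latticePoint k z) (latticePoint k w) = mesh k ∧
        Disjoint (segment ℝ (latticePoint k z) (latticePoint k w)) (disc ε)
  | .line n, .line m => n + 1 = m ∨ m + 1 = n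
  | .star, .line n => n = 1
  | .line n, .star => n = 1
  | .star, .plane z _ =>
      ∃ w, latticePoint k w ∈ disc ε ∧ dist (latticePoint k z) (latticePoint k w) = mesh k
  | .plane z _, .star =>
      ∃ w, latticePoint k w ∈ disc ε ∧ dist (latticePoint k z) (latticePoint k w) = mesh k
  | .star, .star => False
  | .line _, .plane _ _ => False
  | .plane _ _, .line _ => False

lemma mesh_pos (k : ℕ) : 0 < mesh k := by unfold mesh; positivity

/-- The graph `G^k` on `E^k`. -/
def graph (ε : ℝ) (k : ℕ) : SimpleGraph (Vertex ε k) where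
  Adj := Adj ε k
  symm := ⟨by
    rintro (_ | n | ⟨z, hz⟩) (_ | m | ⟨w, hw⟩) h
    case plane.plane =>
      refine ⟨?_, ?_⟩
      · rw [dist_comm]; exact h.1
      · rw [segment_symm]; exact h.2
    case line.line => exact Or.symm h
    all_goals exact h⟩
  loopless := ⟨by
    rintro (_ | n | ⟨z, hz⟩) h
    · exact h
    · rcases h with h | h <;> exact absurd h (PNat.lt_add_right n 1).ne'
    · have h1 := h.1
      rw [dist_self] at h1
      exact (mesh_pos k).ne h1⟩

/-- `v_k(x)`, the number of vertices adjacent to `x`. -/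
def degree (ε : ℝ) (k : ℕ) (x : Vertex ε k) : ℕ := ((graph ε k).neighborSet x).ncard

/-- The mass `m_k(x)` of the vertex `x`. -/
def mass (ε : ℝ) (k : ℕ) : Vertex ε k → ℝ
  | .plane z hz => mesh k ^ 2 / 4 * degree ε k (.plane z hz)
  | .line n => mesh k / 2 * degree ε k (.line n)
  | .star => mesh k / 2 + mesh k ^ 2 / 4 * ((degree ε k .star : ℝ) - 1)

/-- The reference measure `m_k` on `E^k`. -/
def refMeasure (ε : ℝ) (k : ℕ) : Measure (Vertex ε k) :=
  Measure.count.withDensity fun x => ENNReal.ofReal (mass ε k x)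

/-- The two-dimensional part `D_ε^k ∪ {a*_k}` of `E^k`. -/
def planePart (ε : ℝ) (k : ℕ) : Set (Vertex ε k) :=
  {x | x = .star ∨ ∃ z hz, x = .plane z hz}

/-- The one-dimensional part `2^{-k} ℤ₊ ∪ {a*_k}` of `E^k`. -/
def linePart (ε : ℝ) (k : ℕ) : Set (Vertex ε k) :=
  {x | x = .star ∨ ∃ n, x = .line n}

/-- The Dirichlet form `ℰ^k(f, g)`. The sums run over oriented edges, so that each edge is
counted twice. -/
def energy (ε : ℝ) (k : ℕ) (f g : Vertex ε k → ℝ) : ℝ :=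
  (1 / 8) * ∑' e : {e : (graph ε k).Dart // e.fst ∈ planePart ε k ∧ e.snd ∈ planePart ε k},
      (f e.1.fst - f e.1.snd) * (g e.1.fst - g e.1.snd) +
  (2 ^ k / 4) * ∑' e : {e : (graph ε k).Dart // e.fst ∈ linePart ε k ∧ e.snd ∈ linePart ε k},
      (f e.1.fst - f e.1.snd) * (g e.1.fst - g e.1.snd)

/-- The real Hilbert space `L²(E^k, m_k)`. -/
abbrev L2 (ε : ℝ) (k : ℕ) : Type := Lp ℝ 2 (refMeasure ε k)

/-! Helper facts: every vertex has finitely many neighbours and positive mass, and the form is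
bounded on the whole of `L²(E^k, m_k)`. -/

lemma finite_near (k : ℕ) (r : ℝ) (p : EuclideanSpace ℝ (Fin 2)) :
    {w : ℤ × ℤ | dist (latticePoint k w) p ≤ r}.Finite := by
  have hf : ∀ c : ℝ, {n : ℤ | |mesh k * (n : ℝ) - c| ≤ r}.Finite := by
    intro c
    refine (Set.finite_Icc ⌊(c - r) / mesh k⌋ ⌈(c + r) / mesh k⌉).subset ?_
    intro n hn
    have hn' := abs_le.1 (show |mesh k * (n : ℝ) - c| ≤ r from hn)
    have hm := mesh_pos k
    constructor
    · have : (c - r) / mesh k ≤ n := by rw [div_le_iff₀ hm]; linarith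
      exact_mod_cast (Int.floor_le _).trans this
    · have : (n : ℝ) ≤ (c + r) / mesh k := by rw [le_div_iff₀ hm]; linarith
      exact_mod_cast this.trans (Int.le_ceil _)
  refine ((hf (p 0)).prod (hf (p 1))).subset ?_
  intro w hw
  have hw' : ‖latticePoint k w - p‖ ≤ r := by rw [← dist_eq_norm]; exact hw
  constructor
  · have := (PiLp.norm_apply_le (latticePoint k w - p) 0).trans hw'
    simpa [latticePoint] using this
  · have := (PiLp.norm_apply_le (latticePoint k w - p) 1).trans hw'
    simpa [latticePoint] using this

lemma finite_neighborSet (ε : ℝ) (k : ℕ) (x : Vertex ε k) :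
    ((graph ε k).neighborSet x).Finite := by
  have hinj : Set.InjOn (fun y : Vertex ε k => match y with
      | .plane z _ => (some z : Option (ℤ × ℤ)) | _ => none)
      {y | ∃ z hz, y = .plane z hz} := by
    rintro _ ⟨z, hz, rfl⟩ _ ⟨w, hw, rfl⟩ h
    simp only [Option.some.injEq] at h
    subst h; rfl
  have key : ∀ S : Set (ℤ × ℤ), S.Finite →
      {y : Vertex ε k | ∃ z hz, z ∈ S ∧ y = .plane z hz}.Finite := by
    intro S hS
    refine Set.Finite.of_finite_image ((hS.image some).subset ?_)
      (hinj.mono (by rintro _ ⟨z, hz, _, rfl⟩; exact ⟨z, hz, rfl⟩))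
    rintro _ ⟨_, ⟨z, hz, hzS, rfl⟩, rfl⟩
    exact ⟨z, hzS, rfl⟩
  rcases x with _ | n | ⟨z, hz⟩
  · refine ((Set.finite_singleton (Vertex.line 1)).union
      (key _ (finite_near k (ε + mesh k) 0))).subset ?_
    rintro (_ | m | ⟨w, hw⟩) h
    · exact absurd h (by exact id)
    · left; rw [show m = 1 from h]; rfl
    · right
      refine ⟨w, hw, ?_, rfl⟩
      obtain ⟨u, hu, hd⟩ := h
      have hu' : dist (latticePoint k u) 0 ≤ ε := hu
      have := dist_triangle (latticePoint k w) (latticePoint k u) 0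
      show dist (latticePoint k w) 0 ≤ ε + mesh k
      linarith
  · refine ((Set.finite_singleton (Vertex.star (ε := ε) (k := k))).union
      ((Set.finite_Iic (n + 1)).image Vertex.line)).subset ?_
    rintro (_ | m | ⟨w, hw⟩) h
    · left; rfl
    · right
      refine ⟨m, ?_, rfl⟩
      rcases h with h | h
      · exact h.symm.le
      · show m ≤ n + 1
        rw [← h, add_assoc]; exact (PNat.lt_add_right m _).le
    · exact absurd h (by exact id)
  · refine ((Set.finite_singleton (Vertex.star (ε := ε) (k := k))).union
      (key _ (finite_near k (mesh k) (latticePoint k z)))).subset ?_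
    rintro (_ | m | ⟨w, hw⟩) h
    · left; rfl
    · exact absurd h (by exact id)
    · right
      refine ⟨w, hw, ?_, rfl⟩
      show dist (latticePoint k w) (latticePoint k z) ≤ mesh k
      rw [dist_comm]; exact h.1.le

lemma exists_neighbor (ε : ℝ) (k : ℕ) (x : Vertex ε k) : ∃ y, (graph ε k).Adj x y := by
  rcases x with _ | n | ⟨z, hz⟩
  · exact ⟨.line 1, rfl⟩
  · exact ⟨.line (n + 1), Or.inl rfl⟩
  · obtain ⟨s, hs, hsz⟩ : ∃ s : ℤ, (s = 1 ∨ s = -1) ∧ 0 ≤ (z.1 : ℝ) * s := by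
      rcases le_total 0 z.1 with h | h
      · exact ⟨1, Or.inl rfl, by simpa using h⟩
      · exact ⟨-1, Or.inr rfl, by simpa using h⟩
    have hss : (s : ℝ) ^ 2 = 1 := by rcases hs with rfl | rfl <;> norm_num
    have hm := mesh_pos k
    have hseg : Disjoint
        (segment ℝ (latticePoint k z) (latticePoint k (z.1 + s, z.2))) (disc ε) := by
      rw [Set.disjoint_left]
      rintro p ⟨a, b, ha, hb, hab, rfl⟩ hp
      apply hz
      rw [disc, mem_closedBall_zero_iff] at hp ⊢
      refine le_trans ?_ hp
      rw [EuclideanSpace.norm_eq, EuclideanSpace.norm_eq]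
      apply Real.sqrt_le_sqrt
      have ha' : a = 1 - b := by linarith
      subst ha'
      simp only [latticePoint, Fin.sum_univ_two, Real.norm_eq_abs, sq_abs]
      simp
      have e1 : (1 - b) * (mesh k * (z.1 : ℝ)) + b * (mesh k * ((z.1 : ℝ) + s))
          = mesh k * (z.1 + b * s) := by ring
      have e2 : (1 - b) * (mesh k * (z.2 : ℝ)) + b * (mesh k * (z.2 : ℝ))
          = mesh k * z.2 := by ring
      rw [e1, e2, mul_pow, mul_pow]
      have : (z.1 : ℝ) ^ 2 ≤ (z.1 + b * s) ^ 2 := by nlinarith [mul_nonneg hb hsz, sq_nonneg (b * s)]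
      nlinarith [sq_nonneg (mesh k)]
    refine ⟨.plane (z.1 + s, z.2) fun h =>
      Set.disjoint_left.1 hseg (right_mem_segment ℝ _ _) h, ?_, hseg⟩
    rw [dist_eq_norm, EuclideanSpace.norm_eq]
    simp only [latticePoint, Fin.sum_univ_two, Real.norm_eq_abs, sq_abs]
    simp
    have e1 : mesh k * (z.1 : ℝ) - mesh k * ((z.1 : ℝ) + s) = - (mesh k * s) := by ring
    rw [e1, neg_sq, mul_pow, hss, mul_one, Real.sqrt_sq hm.le]

lemma one_le_degree (ε : ℝ) (k : ℕ) (x : Vertex ε k) : (1 : ℝ) ≤ degree ε k x := by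
  have : 0 < degree ε k x := (Set.ncard_pos (finite_neighborSet ε k x)).2 (exists_neighbor ε k x)
  exact_mod_cast this

lemma mass_pos (ε : ℝ) (k : ℕ) (x : Vertex ε k) : 0 < mass ε k x := by
  have hm := mesh_pos k
  have hd := one_le_degree ε k x
  rcases x with _ | n | ⟨z, hz⟩
  · exact add_pos_of_pos_of_nonneg (by positivity) (mul_nonneg (by positivity) (by linarith))
  · exact mul_pos (by positivity) (by linarith)
  · exact mul_pos (by positivity) (by linarith)

lemma degree_le_mass (ε : ℝ) (k : ℕ) (x : Vertex ε k) :
    (degree ε k x : ℝ) ≤ 4 * (2 ^ k) ^ 2 * mass ε k x := by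
  have hd := one_le_degree ε k x
  have h2 : (1 : ℝ) ≤ 2 ^ k := one_le_pow₀ (by norm_num)
  rcases x with _ | n | ⟨z, hz⟩
  · have : 4 * ((2 : ℝ) ^ k) ^ 2 * mass ε k .star = 2 * 2 ^ k + (degree ε k .star - 1) := by
      simp only [mass, mesh]; field_simp; ring
    rw [this]; linarith
  · have : 4 * ((2 : ℝ) ^ k) ^ 2 * mass ε k (.line n) = 2 * 2 ^ k * degree ε k (.line n) := by
      simp only [mass, mesh]; field_simp; ring
    rw [this]; nlinarith
  · have : 4 * ((2 : ℝ) ^ k) ^ 2 * mass ε k (.plane z hz) = degree ε k (.plane z hz) := by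
      simp only [mass, mesh]; field_simp
    rw [this]

lemma refMeasure_singleton (ε : ℝ) (k : ℕ) (x : Vertex ε k) :
    refMeasure ε k {x} = ENNReal.ofReal (mass ε k x) := by
  rw [refMeasure, withDensity_apply _ (measurableSet_singleton x)]
  simp

lemma ae_all (ε : ℝ) (k : ℕ) {P : Vertex ε k → Prop} (h : ∀ᵐ x ∂refMeasure ε k, P x)
    (x : Vertex ε k) : P x := by
  by_contra hx
  have h0 : refMeasure ε k {x} ≤ 0 := by
    rw [← ae_iff.1 h]
    exact measure_mono (by simpa using hx)
  rw [refMeasure_singleton] at h0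
  exact absurd (ENNReal.ofReal_pos.2 (mass_pos ε k x)) (not_lt.2 h0)

lemma tsum_dart_le (ε : ℝ) (k : ℕ) (F : Vertex ε k → ℝ≥0∞) :
    ∑' e : (graph ε k).Dart, F e.fst ≤
      ENNReal.ofReal (4 * (2 ^ k) ^ 2) * ∫⁻ x, F x ∂refMeasure ε k := by
  let φ : (Σ x : Vertex ε k, (graph ε k).neighborSet x) ≃ (graph ε k).Dart :=
    { toFun := fun s => ⟨(s.1, s.2.1), s.2.2⟩
      invFun := fun e => ⟨e.fst, ⟨e.snd, e.adj⟩⟩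
      left_inv := fun _ => rfl
      right_inv := fun _ => rfl }
  calc ∑' e : (graph ε k).Dart, F e.fst
      = ∑' s : (Σ x : Vertex ε k, (graph ε k).neighborSet x), F s.1 := (φ.tsum_eq _).symm
    _ = ∑' (x : Vertex ε k) (_ : (graph ε k).neighborSet x), F x :=
        ENNReal.tsum_sigma fun x (_ : (graph ε k).neighborSet x) => F x
    _ ≤ ∑' x : Vertex ε k, ENNReal.ofReal (4 * (2 ^ k) ^ 2) *
          (ENNReal.ofReal (mass ε k x) * F x) := by
        refine ENNReal.tsum_le_tsum fun x => ?_
        have : Finite ((graph ε k).neighborSet x) := finite_neighborSet ε k x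
        rw [ENNReal.tsum_const, ENat.card_eq_coe_natCard, ← mul_assoc,
          ← ENNReal.ofReal_mul (by positivity)]
        gcongr
        rw [ENat.toENNReal_coe, ← ENNReal.ofReal_natCast]
        exact ENNReal.ofReal_le_ofReal (degree_le_mass ε k x)
    _ = _ := by
        rw [ENNReal.tsum_mul_left, refMeasure,
          lintegral_withDensity_eq_lintegral_mul _ Measurable.of_discrete Measurable.of_discrete,
          lintegral_count]
        rfl

lemma lintegral_sq (ε : ℝ) (k : ℕ) (f : L2 ε k) :
    ∫⁻ x, ENNReal.ofReal (f x ^ 2) ∂refMeasure ε k = ENNReal.ofReal (‖f‖ ^ 2) := by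
  rw [Lp.norm_def, ← ENNReal.toReal_pow, ENNReal.ofReal_toReal (by simp [Lp.eLpNorm_ne_top]),
    eLpNorm_eq_lintegral_rpow_enorm_toReal (by norm_num) (by norm_num)]
  simp only [ENNReal.toReal_ofNat, ENNReal.rpow_ofNat, one_div]
  rw [← ENNReal.rpow_ofNat, ← ENNReal.rpow_mul]
  norm_num
  refine lintegral_congr fun x => ?_
  rw [← Real.enorm_of_nonneg (sq_nonneg (f x)), enorm_pow]

lemma summable_dart (ε : ℝ) (k : ℕ) (f : L2 ε k) :
    (Summable fun e : (graph ε k).Dart => f e.fst ^ 2) ∧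
      ∑' e : (graph ε k).Dart, f e.fst ^ 2 ≤ 4 * (2 ^ k) ^ 2 * ‖f‖ ^ 2 := by
  have h := tsum_dart_le ε k fun x => ENNReal.ofReal (f x ^ 2)
  rw [lintegral_sq, ← ENNReal.ofReal_mul (by positivity)] at h
  have hs : Summable fun e : (graph ε k).Dart => f e.fst ^ 2 := by
    have := ENNReal.summable_toReal (ne_top_of_le_ne_top ENNReal.ofReal_ne_top h)
    simpa [ENNReal.toReal_ofReal, sq_nonneg] using this
  refine ⟨hs, ?_⟩
  rw [← ENNReal.ofReal_tsum_of_nonneg (fun _ => sq_nonneg _) hs] at h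
  exact (ENNReal.ofReal_le_ofReal_iff (by positivity)).1 h

lemma summable_grad (ε : ℝ) (k : ℕ) (f : L2 ε k) :
    (Summable fun e : (graph ε k).Dart => (f e.fst - f e.snd) ^ 2) ∧
      ∑' e : (graph ε k).Dart, (f e.fst - f e.snd) ^ 2 ≤ 16 * (2 ^ k) ^ 2 * ‖f‖ ^ 2 := by
  obtain ⟨h1, h2⟩ := summable_dart ε k f
  let σ : (graph ε k).Dart ≃ (graph ε k).Dart :=
    Function.Involutive.toPerm _ SimpleGraph.Dart.symm_involutive
  have h3 : Summable fun e : (graph ε k).Dart => f e.snd ^ 2 := σ.summable_iff.2 h1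
  have h4 : ∑' e : (graph ε k).Dart, f e.snd ^ 2 = ∑' e : (graph ε k).Dart, f e.fst ^ 2 :=
    σ.tsum_eq fun e : (graph ε k).Dart => f e.fst ^ 2
  have hle : ∀ e : (graph ε k).Dart,
      (f e.fst - f e.snd) ^ 2 ≤ 2 * f e.fst ^ 2 + 2 * f e.snd ^ 2 := fun e => by
    nlinarith [sq_nonneg (f e.fst + f e.snd)]
  have hs := (h1.mul_left 2).add (h3.mul_left 2)
  have hs' := Summable.of_nonneg_of_le (fun _ => sq_nonneg _) hle hs
  refine ⟨hs', (hs'.tsum_le_tsum hle hs).trans ?_⟩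
  rw [(h1.mul_left 2).tsum_add (h3.mul_left 2), tsum_mul_left, tsum_mul_left, h4]
  linarith

lemma summable_grad_mul (ε : ℝ) (k : ℕ) (f g : L2 ε k) :
    Summable fun e : (graph ε k).Dart => (f e.fst - f e.snd) * (g e.fst - g e.snd) := by
  refine Summable.of_norm_bounded ((summable_grad ε k f).1.add (summable_grad ε k g).1) fun e => ?_
  rw [Real.norm_eq_abs, abs_le]
  constructor <;> nlinarith [sq_nonneg (f e.fst - f e.snd + (g e.fst - g e.snd)),
    sq_nonneg (f e.fst - f e.snd - (g e.fst - g e.snd)), sq_nonneg (f e.fst - f e.snd),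
    sq_nonneg (g e.fst - g e.snd)]

lemma coe_add (ε : ℝ) (k : ℕ) (f g : L2 ε k) (x : Vertex ε k) : (f + g) x = f x + g x :=
  ae_all ε k (Lp.coeFn_add f g) x

lemma coe_smul (ε : ℝ) (k : ℕ) (c : ℝ) (f : L2 ε k) (x : Vertex ε k) : (c • f) x = c * f x :=
  ae_all ε k (Lp.coeFn_smul c f) x

lemma energy_comm (ε : ℝ) (k : ℕ) (f g : Vertex ε k → ℝ) : energy ε k f g = energy ε k g f := by
  simp only [energy, mul_comm]

lemma energy_add (ε : ℝ) (k : ℕ) (f g h : L2 ε k) :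
    energy ε k (f + g : L2 ε k) h = energy ε k f h + energy ε k g h := by
  have key : ∀ p : (graph ε k).Dart → Prop,
      ∑' e : {e // p e}, ((f + g : L2 ε k) e.1.fst - (f + g : L2 ε k) e.1.snd) * (h e.1.fst - h e.1.snd) =
      ∑' e : {e // p e}, (f e.1.fst - f e.1.snd) * (h e.1.fst - h e.1.snd) +
      ∑' e : {e // p e}, (g e.1.fst - g e.1.snd) * (h e.1.fst - h e.1.snd) := by
    intro p
    have h1 := (summable_grad_mul ε k f h).comp_injective (Subtype.val_injective (p := p))
    have h2 := (summable_grad_mul ε k g h).comp_injective (Subtype.val_injective (p := p))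
    refine Eq.trans ?_ (h1.tsum_add h2)
    refine tsum_congr fun e => ?_
    simp only [coe_add, Function.comp]
    ring
  unfold energy
  have h1 := key fun e => e.fst ∈ planePart ε k ∧ e.snd ∈ planePart ε k
  have h2 := key fun e => e.fst ∈ linePart ε k ∧ e.snd ∈ linePart ε k
  rw [h1, h2]
  ring

lemma energy_smul (ε : ℝ) (k : ℕ) (c : ℝ) (f h : L2 ε k) :
    energy ε k (c • f : L2 ε k) h = c * energy ε k f h := by
  unfold energy
  simp only [coe_smul, ← mul_sub, mul_assoc, tsum_mul_left]
  ring

lemma energy_nonneg (ε : ℝ) (k : ℕ) (f : Vertex ε k → ℝ) : 0 ≤ energy ε k f f := by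
  unfold energy
  have h1 : ∀ a : ℝ, 0 ≤ a * a := mul_self_nonneg
  exact add_nonneg (mul_nonneg (by norm_num) (tsum_nonneg fun _ => h1 _))
    (mul_nonneg (by positivity) (tsum_nonneg fun _ => h1 _))

lemma energy_le (ε : ℝ) (k : ℕ) (f : L2 ε k) :
    energy ε k f f ≤ (1 / 8 + 2 ^ k / 4) * (16 * (2 ^ k) ^ 2) * ‖f‖ ^ 2 := by
  obtain ⟨h1, h2⟩ := summable_grad ε k f
  have key : ∀ p : (graph ε k).Dart → Prop,
      ∑' e : {e // p e}, (f e.1.fst - f e.1.snd) * (f e.1.fst - f e.1.snd) ≤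
        16 * (2 ^ k) ^ 2 * ‖f‖ ^ 2 := by
    intro p
    simp only [← sq]
    exact (h1.tsum_subtype_le _ {e | p e} fun _ => sq_nonneg _).trans h2
  have h3 := key fun e => e.fst ∈ planePart ε k ∧ e.snd ∈ planePart ε k
  have h4 := key fun e => e.fst ∈ linePart ε k ∧ e.snd ∈ linePart ε k
  unfold energy
  have := mul_le_mul_of_nonneg_left h3 (show (0 : ℝ) ≤ 1 / 8 by norm_num)
  have := mul_le_mul_of_nonneg_left h4 (show (0 : ℝ) ≤ 2 ^ k / 4 by positivity)
  linarith

/-- The form `ℰ^k` is represented by a unique bounded operator on `L²(E^k, m_k)`. -/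
theorem existsUnique_generator (ε : ℝ) (k : ℕ) :
    ∃! A : L2 ε k →L[ℝ] L2 ε k, ∀ f g : L2 ε k, inner ℝ (A f) g = -energy ε k f g := by
  let B₀ : LinearMap.BilinForm ℝ (L2 ε k) := LinearMap.mk₂ ℝ (fun f g => energy ε k f g)
    (energy_add ε k) (energy_smul ε k)
    (fun f g h => by
      rw [energy_comm, energy_add, energy_comm ε k g, energy_comm ε k h])
    (fun c f g => by rw [energy_comm, energy_smul, energy_comm ε k g]; rfl)
  set C : ℝ := (1 / 8 + 2 ^ k / 4) * (16 * (2 ^ k) ^ 2) with hC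
  have hC0 : 0 ≤ C := by positivity
  let B : L2 ε k →L[ℝ] L2 ε k →L[ℝ] ℝ := B₀.mkContinuous₂ C fun f g => by
    have h := LinearMap.BilinForm.apply_mul_apply_le_of_forall_zero_le B₀
      (fun f => energy_nonneg ε k f) f g
    have h1 : B₀ g f = B₀ f g := energy_comm ε k _ _
    have hf : B₀ f f ≤ C * ‖f‖ ^ 2 := energy_le ε k f
    have hg : B₀ g g ≤ C * ‖g‖ ^ 2 := energy_le ε k g
    rw [h1, ← sq] at h
    rw [Real.norm_eq_abs]
    refine abs_le_of_sq_le_sq (h.trans ?_) (by positivity)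
    refine (mul_le_mul hf hg (energy_nonneg ε k g) (by positivity)).trans_eq ?_
    ring
  refine ⟨-InnerProductSpace.continuousLinearMapOfBilin (𝕜 := ℝ) B, fun f g => ?_, fun A hA => ?_⟩
  · simp only [neg_apply, inner_neg_left,
      InnerProductSpace.continuousLinearMapOfBilin_apply]
    rfl
  · ext1 f
    refine ext_inner_right ℝ fun g => ?_
    simp only [neg_apply, inner_neg_left,
      InnerProductSpace.continuousLinearMapOfBilin_apply]
    exact hA f g

/-- The generator `L^k` of the Dirichlet form: the operator with `⟨L^k f, g⟩ = -ℰ^k(f, g)` for all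
`f, g ∈ L²(E^k, m_k)`. -/
def generator (ε : ℝ) (k : ℕ) : L2 ε k →L[ℝ] L2 ε k := (existsUnique_generator ε k).choose

/-- The transition semigroup `P_t^k = exp(t L^k)` on `L²(E^k, m_k)` associated with the Dirichlet
form. -/
def semigroup (ε : ℝ) (k : ℕ) (t : ℝ) : L2 ε k →L[ℝ] L2 ε k :=
  NormedSpace.exp (t • generator ε k)

lemma refMeasure_singleton_ne_top (ε : ℝ) (k : ℕ) (x : Vertex ε k) :
    refMeasure ε k {x} ≠ ∞ := by
  rw [refMeasure_singleton]; exact ENNReal.ofReal_ne_top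

/-- The transition density `p_k(t, x, y)` of `P_t^k` with respect to `m_k`, that is,
`(P_t^k 1_{y})(x) / m_k(y)`. (Every vertex has positive mass, so elements of `L²(E^k, m_k)` have
well-defined values at vertices.) -/
def heatKernel (ε : ℝ) (k : ℕ) (t : ℝ) (x y : Vertex ε k) : ℝ :=
  semigroup ε k t
    (indicatorConstLp 2 (measurableSet_singleton y) (refMeasure_singleton_ne_top ε k y) (1 : ℝ)) x /
    mass ε k y

/-- The distance `d_k(x, y)`: `2^{-k}` times the graph distance in `G^k`. -/
def graphDist (ε : ℝ) (k : ℕ) (x y : Vertex ε k) : ℝ := mesh k * (graph ε k).dist x y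

end VaryingDim

end

namespace VaryingDim

/-! A Nash inequality gives the on-diagonal bound, and exponentially weighted `L²` norms give the
off-diagonal factor. Every constant depends on `ε` alone.

On-diagonal. Let N(t) = ‖P_t δ_x‖², so that N' = -2ℰ. For nonnegative f of mass at most 1, `nash`
says that either ‖f‖⁴ ≲ ℰ(f,f) (planar behaviour) or ‖f‖⁶ ≲ ℰ(f,f) (linear behaviour). Hence 1/N +
1/N² grows at least linearly and N(t) ≲ 1/t ∨ 1/√t (`norm_sq_semigroup_le`). P_t preserves
positivity and does not increase mass, because it is a Poisson average of powers of the random walk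
operator.

Nash. Discrete Gagliardo–Nirenberg inequalities are applied to f². In the plane, f is pulled back to
ℤ² by sending the disc to `a*_k`, which bounds Σ f⁴; on the half-line, telescoping bounds sup f⁴.
The mass of `a*_k` is controlled because the disc contains at least ε2^k lattice points
(`mass_le_card_fiber`). Splitting the values of f at a level comparable to ‖f‖² then yields the
alternative.

Off-diagonal. The squared norm of P_t f with weight e^{βd} grows at most like e^{2β²t} when β ≤ 2^k
(`norm_sq_weightOp_semigroup_le`). Cauchy–Schwarz bounds the weighted norm at slope β by the one at
slope 2β and the unweighted one; doubling β while quartering time preserves β²t, and the iteration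
ends at β ≈ 2^k, where the trivial bound at time 0 suffices (`norm_sq_weightOp_semigroup_delta_le`).
Writing p_t(x,y) as an inner product of two half-time kernels and distributing the weight by the
triangle inequality concludes (`heatKernel_le_of_diag`). -/

instance (ε : ℝ) (k : ℕ) : Countable (Vertex ε k) := by
  let φ : Vertex ε k → Option (ℕ+ ⊕ ℤ × ℤ)
    | .star => none
    | .line n => some (.inl n)
    | .plane z _ => some (.inr z)
  refine Function.Injective.countable (f := φ) ?_
  rintro (_ | n | ⟨z, hz⟩) (_ | m | ⟨w, hw⟩) h <;> simp_all [φ]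

lemma mesh_mul_two_pow (k : ℕ) : mesh k * 2 ^ k = 1 := by
  unfold mesh; field_simp

variable {ε : ℝ} {k : ℕ}

/-! ### Norms, inner products and point evaluations as weighted sums -/

lemma refMeasure_real_singleton (x : Vertex ε k) : (refMeasure ε k).real {x} = mass ε k x := by
  rw [measureReal_def, refMeasure_singleton, ENNReal.toReal_ofReal (mass_pos ε k x).le]

lemma inner_eq_tsum (f g : L2 ε k) : inner ℝ f g = ∑' x, f x * g x * mass ε k x := by
  rw [L2.inner_def, integral_countable (L2.integrable_inner f g)]
  refine tsum_congr fun x => ?_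
  rw [refMeasure_real_singleton]
  simp only [smul_eq_mul, RCLike.inner_apply, conj_trivial]
  ring

lemma norm_sq_eq_tsum (f : L2 ε k) : ‖f‖ ^ 2 = ∑' x, f x ^ 2 * mass ε k x := by
  rw [← real_inner_self_eq_norm_sq, inner_eq_tsum]
  simp only [sq]

lemma lintegral_refMeasure (F : Vertex ε k → ℝ≥0∞) :
    ∫⁻ x, F x ∂refMeasure ε k = ∑' x, ENNReal.ofReal (mass ε k x) * F x := by
  rw [refMeasure, lintegral_withDensity_eq_lintegral_mul _ Measurable.of_discrete
    Measurable.of_discrete, lintegral_count]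
  rfl

lemma summable_sq_mass (f : L2 ε k) : Summable fun x => f x ^ 2 * mass ε k x := by
  have h : ∫⁻ x, ENNReal.ofReal (f x ^ 2) ∂refMeasure ε k ≠ ∞ := by
    rw [lintegral_sq]; exact ENNReal.ofReal_ne_top
  rw [lintegral_refMeasure] at h
  have := ENNReal.summable_toReal h
  refine this.congr fun x => ?_
  rw [ENNReal.toReal_mul, ENNReal.toReal_ofReal (mass_pos ε k x).le,
    ENNReal.toReal_ofReal (sq_nonneg _), mul_comm]

lemma coe_toLp {f : Vertex ε k → ℝ} (hf : MemLp f 2 (refMeasure ε k)) (x : Vertex ε k) :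
    hf.toLp f x = f x :=
  ae_all ε k hf.coeFn_toLp x

/-- The function `1_{y} / m_k(y)`. -/
noncomputable def delta (y : Vertex ε k) : L2 ε k :=
  (mass ε k y)⁻¹ •
    indicatorConstLp 2 (measurableSet_singleton y) (refMeasure_singleton_ne_top ε k y) (1 : ℝ)

lemma indicator_apply (x y : Vertex ε k) :
    (indicatorConstLp 2 (measurableSet_singleton y) (refMeasure_singleton_ne_top ε k y) (1 : ℝ) :
      L2 ε k) x = ({y} : Set (Vertex ε k)).indicator (fun _ => (1 : ℝ)) x :=
  ae_all ε k indicatorConstLp_coeFn x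

lemma delta_apply_self (x : Vertex ε k) : delta x x = (mass ε k x)⁻¹ := by
  rw [delta, coe_smul, indicator_apply]; simp

lemma delta_apply_ne {x y : Vertex ε k} (h : y ≠ x) : delta x y = 0 := by
  rw [delta, coe_smul, indicator_apply]; simp [h]

lemma inner_delta (x : Vertex ε k) (f : L2 ε k) : inner ℝ (delta x) f = f x := by
  rw [inner_eq_tsum, tsum_eq_single x fun y hy => by simp [delta_apply_ne hy], delta_apply_self]
  have := (mass_pos ε k x).ne'
  field_simp

lemma norm_delta_sq (x : Vertex ε k) : ‖delta x‖ ^ 2 = (mass ε k x)⁻¹ := by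
  rw [← real_inner_self_eq_norm_sq, inner_delta, delta_apply_self]

lemma heatKernel_eq (t : ℝ) (x y : Vertex ε k) :
    heatKernel ε k t x y = inner ℝ (delta x) (semigroup ε k t (delta y)) := by
  rw [inner_delta, delta, map_smul, coe_smul, heatKernel, div_eq_inv_mul]

/-! ### Conductances and the form as a sum over oriented edges -/

/-- The conductance of an edge. -/
noncomputable def conductance : Vertex ε k → Vertex ε k → ℝ
  | .plane _ _, _ => 1 / 4
  | _, .plane _ _ => 1 / 4
  | _, _ => 2 ^ k / 2

lemma conductance_comm (x y : Vertex ε k) : conductance x y = conductance y x := by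
  rcases x with _ | n | ⟨z, hz⟩ <;> rcases y with _ | m | ⟨w, hw⟩ <;> rfl

lemma conductance_pos (x y : Vertex ε k) : 0 < conductance x y := by
  rcases x with _ | n | ⟨z, hz⟩ <;> rcases y with _ | m | ⟨w, hw⟩ <;>
    simp only [conductance] <;> positivity

lemma conductance_le (x y : Vertex ε k) : conductance x y ≤ 2 ^ k / 2 := by
  have h2 : (1 : ℝ) ≤ 2 ^ k := one_le_pow₀ (by norm_num)
  rcases x with _ | n | ⟨z, hz⟩ <;> rcases y with _ | m | ⟨w, hw⟩ <;>
    simp only [conductance] <;> linarith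

/-- The finite set of neighbours of a vertex. -/
noncomputable def neighbors (x : Vertex ε k) : Finset (Vertex ε k) :=
  (finite_neighborSet ε k x).toFinset

lemma mem_neighbors {x y : Vertex ε k} : y ∈ neighbors x ↔ (graph ε k).Adj x y := by
  simp [neighbors]

lemma card_neighbors (x : Vertex ε k) : ((neighbors x).card : ℝ) = degree ε k x := by
  rw [neighbors, degree, Set.ncard_eq_toFinset_card _ (finite_neighborSet ε k x)]

/-- The masses are exactly those for which the associated random walk jumps at the constant rate
4^k. At `a*_k` the edge to the half-line accounts for the summand 2^{-k}/2 and the remaining v_k - 1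
edges for the rest. -/
lemma sum_conductance (x : Vertex ε k) :
    ∑ y ∈ neighbors x, conductance x y = (2 ^ k) ^ 2 * mass ε k x := by
  classical
  have hm := mesh_mul_two_pow k
  rcases x with _ | n | ⟨z, hz⟩
  · have h1 : (Vertex.line 1 : Vertex ε k) ∈ neighbors .star := mem_neighbors.2 rfl
    have h2 : ∀ y ∈ (neighbors (.star : Vertex ε k)).erase (.line 1),
        conductance .star y = 1 / 4 := by
      intro y hy
      obtain ⟨hy1, hy2⟩ := Finset.mem_erase.1 hy
      rw [mem_neighbors] at hy2
      rcases y with _ | m | ⟨w, hw⟩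
      · exact absurd hy2 (by exact id)
      · exact absurd (show Vertex.line m = Vertex.line 1 by rw [show m = 1 from hy2]) hy1
      · rfl
    rw [← Finset.add_sum_erase _ _ h1, Finset.sum_congr rfl h2, Finset.sum_const,
      Finset.card_erase_of_mem h1, nsmul_eq_mul, Nat.cast_sub (Finset.card_pos.2 ⟨_, h1⟩),
      card_neighbors]
    simp only [mass, conductance, Nat.cast_one]
    have : (2 ^ k : ℝ) ^ 2 * (mesh k / 2 + mesh k ^ 2 / 4 * (degree ε k .star - 1)) =
      (mesh k * 2 ^ k) * 2 ^ k / 2 + (mesh k * 2 ^ k) ^ 2 / 4 * (degree ε k .star - 1) := by ring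
    rw [this, hm]; ring
  · have h2 : ∀ y ∈ neighbors (.line n : Vertex ε k), conductance (.line n) y = 2 ^ k / 2 := by
      intro y hy
      rw [mem_neighbors] at hy
      rcases y with _ | m | ⟨w, hw⟩
      · rfl
      · rfl
      · exact absurd hy (by exact id)
    rw [Finset.sum_congr rfl h2, Finset.sum_const, nsmul_eq_mul, card_neighbors]
    simp only [mass]
    have : (2 ^ k : ℝ) ^ 2 * (mesh k / 2 * degree ε k (.line n)) =
      (mesh k * 2 ^ k) * 2 ^ k / 2 * degree ε k (.line n) := by ring
    rw [this, hm]; ring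
  · have h2 : ∀ y ∈ neighbors (.plane z hz : Vertex ε k),
        conductance (.plane z hz) y = 1 / 4 := fun y _ => by rfl
    rw [Finset.sum_congr rfl h2, Finset.sum_const, nsmul_eq_mul, card_neighbors]
    simp only [mass]
    have : (2 ^ k : ℝ) ^ 2 * (mesh k ^ 2 / 4 * degree ε k (.plane z hz)) =
      (mesh k * 2 ^ k) ^ 2 / 4 * degree ε k (.plane z hz) := by ring
    rw [this, hm]; ring

/-- Oriented edges, grouped by their first vertex. -/
def dartEquiv (ε : ℝ) (k : ℕ) :
    (Σ x : Vertex ε k, {y // y ∈ neighbors x}) ≃ (graph ε k).Dart where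
  toFun s := ⟨(s.1, s.2.1), mem_neighbors.1 s.2.2⟩
  invFun e := ⟨e.fst, ⟨e.snd, mem_neighbors.2 e.adj⟩⟩
  left_inv _ := rfl
  right_inv _ := rfl

lemma tsum_conductance_fst {F : Vertex ε k → ℝ} (hF : ∀ x, 0 ≤ F x)
    (hs : Summable fun x => F x * mass ε k x) :
    (Summable fun e : (graph ε k).Dart => conductance e.fst e.snd * F e.fst) ∧
      ∑' e : (graph ε k).Dart, conductance e.fst e.snd * F e.fst =
        (2 ^ k) ^ 2 * ∑' x, F x * mass ε k x := by
  have hx : ∀ x : Vertex ε k, ∑' y : {y // y ∈ neighbors x}, conductance x y.1 * F x =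
      (2 ^ k) ^ 2 * (F x * mass ε k x) := by
    intro x
    rw [tsum_mul_right, Finset.tsum_subtype (neighbors x) (fun y => conductance x y),
      sum_conductance]
    ring
  have hs1 : Summable fun s : (Σ x : Vertex ε k, {y // y ∈ neighbors x}) =>
      conductance s.1 s.2.1 * F s.1 := by
    rw [summable_sigma_of_nonneg fun s => mul_nonneg (conductance_pos _ _).le (hF _)]
    refine ⟨fun x => Summable.of_finite, ?_⟩
    simp only [hx]
    exact hs.mul_left _
  constructor
  · exact (dartEquiv ε k).summable_iff.1 hs1
  · rw [← (dartEquiv ε k).tsum_eq]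
    refine (hs1.tsum_sigma).trans ?_
    simp only [hx, tsum_mul_left]

/-- The two parts meet only in `a*_k`, which carries no loop, so each edge is counted in exactly one
of the two sums of the form. -/
lemma mem_parts_of_adj {x y : Vertex ε k} (h : (graph ε k).Adj x y) :
    (x ∈ planePart ε k ∧ y ∈ planePart ε k ∧ conductance x y = 1 / 4 ∧
      ¬(x ∈ linePart ε k ∧ y ∈ linePart ε k)) ∨
    (x ∈ linePart ε k ∧ y ∈ linePart ε k ∧ conductance x y = 2 ^ k / 2 ∧
      ¬(x ∈ planePart ε k ∧ y ∈ planePart ε k)) := by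
  have h' : Adj ε k x y := h
  rcases x with _ | n | ⟨⟨a, b⟩, hz⟩ <;> rcases y with _ | m | ⟨⟨c, d⟩, hw⟩ <;>
    simp_all [planePart, linePart, conductance, Adj]

lemma summable_conductance_grad_mul (f g : L2 ε k) :
    Summable fun e : (graph ε k).Dart =>
      conductance e.fst e.snd * ((f e.fst - f e.snd) * (g e.fst - g e.snd)) := by
  refine Summable.of_norm_bounded (((summable_grad_mul ε k f g).norm).mul_left (2 ^ k / 2))
    fun e => ?_
  rw [norm_mul, Real.norm_of_nonneg (conductance_pos _ _).le]
  exact mul_le_mul_of_nonneg_right (conductance_le _ _) (norm_nonneg _)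

lemma energy_eq_tsum (f g : L2 ε k) :
    energy ε k f g = 1 / 2 * ∑' e : (graph ε k).Dart,
      conductance e.fst e.snd * ((f e.fst - f e.snd) * (g e.fst - g e.snd)) := by
  have hs := summable_grad_mul ε k f g
  set G : (graph ε k).Dart → ℝ := fun e => (f e.fst - f e.snd) * (g e.fst - g e.snd) with hG
  let A : Set (graph ε k).Dart := {e | e.fst ∈ planePart ε k ∧ e.snd ∈ planePart ε k}
  let B : Set (graph ε k).Dart := {e | e.fst ∈ linePart ε k ∧ e.snd ∈ linePart ε k}
  have hA : Summable (A.indicator G) := hs.indicator A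
  have hB : Summable (B.indicator G) := hs.indicator B
  have key : ∀ e, conductance e.fst e.snd * G e =
      1 / 4 * A.indicator G e + 2 ^ k / 2 * B.indicator G e := by
    intro e
    rcases mem_parts_of_adj e.adj with ⟨h1, h2, h3, h4⟩ | ⟨h1, h2, h3, h4⟩
    · rw [h3, Set.indicator_of_mem (show e ∈ A from ⟨h1, h2⟩),
        Set.indicator_of_notMem (show e ∉ B from h4)]
      ring
    · rw [h3, Set.indicator_of_mem (show e ∈ B from ⟨h1, h2⟩),
        Set.indicator_of_notMem (show e ∉ A from h4)]
      ring
  have hsum : ∑' e, conductance e.fst e.snd * G e =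
      1 / 4 * ∑' e : A, G e + 2 ^ k / 2 * ∑' e : B, G e := by
    rw [tsum_subtype, tsum_subtype, ← tsum_mul_left, ← tsum_mul_left,
      ← (hA.mul_left _).tsum_add (hB.mul_left _)]
    exact tsum_congr key
  rw [hsum, energy]
  change 1 / 8 * ∑' e : A, G e + 2 ^ k / 4 * ∑' e : B, G e = _
  ring

/-! ### The generator and its semigroup -/

lemma inner_generator (f g : L2 ε k) : inner ℝ (generator ε k f) g = -energy ε k f g :=
  (existsUnique_generator ε k).choose_spec.1 f g

lemma generator_isSymmetric (f g : L2 ε k) :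
    inner ℝ (generator ε k f) g = inner ℝ f (generator ε k g) := by
  rw [inner_generator, real_inner_comm, inner_generator, energy_comm]

lemma semigroup_zero : semigroup ε k 0 = 1 := by
  rw [semigroup, zero_smul, NormedSpace.exp_zero]

lemma semigroup_add (s t : ℝ) (f : L2 ε k) :
    semigroup ε k (s + t) f = semigroup ε k s (semigroup ε k t f) := by
  let _ : NormedAlgebra ℚ (L2 ε k →L[ℝ] L2 ε k) := NormedAlgebra.restrictScalars ℚ ℝ _
  have hc : Commute (s • generator ε k) (t • generator ε k) :=
    ((Commute.refl (generator ε k)).smul_left s).smul_right t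
  rw [semigroup, add_smul, NormedSpace.exp_add_of_commute hc]
  rfl

lemma inner_semigroup (t : ℝ) (f g : L2 ε k) :
    inner ℝ (semigroup ε k t f) g = inner ℝ f (semigroup ε k t g) := by
  have hL : IsSelfAdjoint (generator ε k) :=
    ContinuousLinearMap.isSelfAdjoint_iff_isSymmetric.2 generator_isSymmetric
  have h : star (semigroup ε k t) = semigroup ε k t := by
    rw [semigroup, NormedSpace.star_exp, star_smul, hL.star_eq]; rfl
  rw [← ContinuousLinearMap.adjoint_inner_right, ← ContinuousLinearMap.star_eq_adjoint, h]

lemma hasDerivAt_semigroup (f : L2 ε k) (t : ℝ) :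
    HasDerivAt (fun t => semigroup ε k t f) (generator ε k (semigroup ε k t f)) t := by
  have h := hasDerivAt_exp_smul_const' (𝕂 := ℝ) (generator ε k) t
  exact h.clm_apply (hasDerivAt_const t f) |>.congr_deriv (by simp [semigroup])

/-- The generator is bounded, so P_t has the inverse P_{-t}. This permits division by the norm in
the differential inequality. -/
lemma semigroup_ne_zero {f : L2 ε k} (hf : f ≠ 0) (t : ℝ) : semigroup ε k t f ≠ 0 := by
  intro h
  have := semigroup_add (-t) t f
  rw [h, neg_add_cancel, semigroup_zero, map_zero] at this
  exact hf this

/-! ### Positivity and contraction in `L¹` -/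

/-- For c ≥ 0 the coefficients are nonnegative, so sign and size bounds on l(P^j f) that hold for
all j pass to the exponential. -/
lemma hasSum_exp_smul_apply {H : Type*} [NormedAddCommGroup H] [NormedSpace ℝ H] [CompleteSpace H]
    (P : H →L[ℝ] H) (l : H →L[ℝ] ℝ) (f : H) (c : ℝ) :
    HasSum (fun j : ℕ => (j.factorial : ℝ)⁻¹ * c ^ j * l ((P ^ j) f))
      (l (NormedSpace.exp (c • P) f)) := by
  have h := NormedSpace.exp_series_hasSum_exp' (𝕂 := ℝ) (c • P)
  have h1 := (h.mapL ((ContinuousLinearMap.apply ℝ H f))).mapL l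
  have he : (fun j : ℕ => (j.factorial : ℝ)⁻¹ * c ^ j * l ((P ^ j) f)) = fun j : ℕ =>
      l (ContinuousLinearMap.apply ℝ H f ((j.factorial : ℝ)⁻¹ • (c • P) ^ j)) := by
    funext j
    simp [smul_pow, mul_assoc]
  rw [he]
  exact h1

/-- Tested against `delta x`, the form sees only the oriented edges that start or end at x. Reversal
shows that the two families contribute equally, which absorbs the factor 1/2. -/
lemma conductance_sum_eq_generator (f : L2 ε k) (x : Vertex ε k) :
    mass ε k x * generator ε k f x =
      ∑ y ∈ neighbors x, conductance x y * (f y - f x) := by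
  classical
  have h1 : mass ε k x * generator ε k f x = -(mass ε k x * energy ε k f (delta x)) := by
    rw [← inner_delta, real_inner_comm, inner_generator, mul_neg]
  have hd : ∀ y : Vertex ε k, mass ε k x * delta x y = if y = x then 1 else 0 := by
    intro y
    split_ifs with h
    · rw [h, delta_apply_self, mul_inv_cancel₀ (mass_pos ε k x).ne']
    · rw [delta_apply_ne h, mul_zero]
  let G : (graph ε k).Dart → ℝ := fun e => conductance e.fst e.snd *
    (if e.fst = x then f e.fst - f e.snd else 0)
  let G' : (graph ε k).Dart → ℝ := fun e => conductance e.fst e.snd *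
    (if e.snd = x then f e.snd - f e.fst else 0)
  let S : Finset (Σ x : Vertex ε k, {y // y ∈ neighbors x}) :=
    Finset.univ.map ⟨Sigma.mk x, sigma_mk_injective⟩
  have hG : HasSum G (∑ y ∈ neighbors x, conductance x y * (f x - f y)) := by
    rw [← (dartEquiv ε k).hasSum_iff]
    have : ∑ y ∈ neighbors x, conductance x y * (f x - f y) =
        ∑ s ∈ S, (G ∘ dartEquiv ε k) s := by
      rw [Finset.sum_map, ← Finset.sum_coe_sort]
      refine Finset.sum_congr rfl fun y _ => ?_
      simp [G, dartEquiv]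
    rw [this]
    refine hasSum_sum_of_ne_finset_zero fun s hs => ?_
    have hsx : s.1 ≠ x := by
      rintro rfl
      exact hs (Finset.mem_map.2 ⟨s.2, Finset.mem_univ _, rfl⟩)
    simp [G, dartEquiv, hsx]
  let σ : (graph ε k).Dart ≃ (graph ε k).Dart :=
    Function.Involutive.toPerm _ SimpleGraph.Dart.symm_involutive
  have hG' : HasSum G' (∑ y ∈ neighbors x, conductance x y * (f x - f y)) := by
    rw [← σ.hasSum_iff]
    have : G' ∘ σ = G := by
      funext e
      change conductance e.snd e.fst * (if e.fst = x then f e.fst - f e.snd else 0) = _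
      rw [conductance_comm]
    rwa [this]
  have hE : mass ε k x * energy ε k f (delta x) =
      ∑ y ∈ neighbors x, conductance x y * (f x - f y) := by
    rw [energy_eq_tsum, ← mul_assoc, mul_comm (mass ε k x), mul_assoc, ← tsum_mul_left]
    have : ∀ e : (graph ε k).Dart, mass ε k x * (conductance e.fst e.snd *
        ((f e.fst - f e.snd) * (delta x e.fst - delta x e.snd))) = G e + G' e := by
      intro e
      have h2 : mass ε k x * (conductance e.fst e.snd *
        ((f e.fst - f e.snd) * (delta x e.fst - delta x e.snd))) =
        conductance e.fst e.snd * ((f e.fst - f e.snd) *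
          (mass ε k x * delta x e.fst - mass ε k x * delta x e.snd)) := by ring
      rw [h2, hd, hd]
      simp only [G, G']
      split_ifs <;> ring
    simp only [this]
    rw [(hG.add hG').tsum_eq]
    ring
  rw [h1, hE, ← Finset.sum_neg_distrib]
  exact Finset.sum_congr rfl fun y _ => by ring

/-- The one-step averaging operator `1 + 2^{-2k} L^k` of the simple random walk. -/
noncomputable def walk (ε : ℝ) (k : ℕ) : L2 ε k →L[ℝ] L2 ε k :=
  1 + mesh k ^ 2 • generator ε k

lemma mass_mul_walk (f : L2 ε k) (x : Vertex ε k) :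
    mass ε k x * walk ε k f x = mesh k ^ 2 * ∑ y ∈ neighbors x, conductance x y * f y := by
  have h : walk ε k f = f + mesh k ^ 2 • generator ε k f := rfl
  rw [h, coe_add, coe_smul, mul_add, mul_left_comm, conductance_sum_eq_generator]
  simp only [mul_sub, Finset.sum_sub_distrib, ← Finset.sum_mul, sum_conductance]
  have : mesh k ^ 2 * ((2 ^ k) ^ 2 * mass ε k x * f x) =
    (mesh k * 2 ^ k) ^ 2 * (mass ε k x * f x) := by ring
  rw [this, mesh_mul_two_pow]
  ring

/-- Nonnegative functions with integral at most `M`. -/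
def IsSubDensity (M : ℝ) (f : L2 ε k) : Prop :=
  (∀ x, 0 ≤ f x) ∧ ∀ S : Finset (Vertex ε k), ∑ x ∈ S, f x * mass ε k x ≤ M

/-- Interchanging the sums and using symmetric conductances, the walk redistributes the mass at y
among its neighbours; restricting to a finite set S can only lose mass. -/
lemma IsSubDensity.walk {M : ℝ} {f : L2 ε k} (hf : IsSubDensity M f) :
    IsSubDensity M (walk ε k f) := by
  classical
  constructor
  · intro x
    have h := mass_mul_walk f x
    have h0 : 0 ≤ mass ε k x * VaryingDim.walk ε k f x := by
      rw [h]
      exact mul_nonneg (sq_nonneg _)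
        (Finset.sum_nonneg fun y _ => mul_nonneg (conductance_pos _ _).le (hf.1 y))
    exact nonneg_of_mul_nonneg_right h0 (mass_pos ε k x)
  · intro S
    let T := S.biUnion neighbors
    have h1 : ∑ x ∈ S, VaryingDim.walk ε k f x * mass ε k x =
        mesh k ^ 2 * ∑ x ∈ S, ∑ y ∈ neighbors x, conductance x y * f y := by
      rw [Finset.mul_sum]
      exact Finset.sum_congr rfl fun x _ => by rw [mul_comm, mass_mul_walk]
    have h2 : ∑ x ∈ S, ∑ y ∈ neighbors x, conductance x y * f y =
        ∑ y ∈ T, ∑ x ∈ S with x ∈ neighbors y, conductance x y * f y := by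
      refine Finset.sum_comm' fun x y => ?_
      simp only [Finset.mem_filter, T, Finset.mem_biUnion, mem_neighbors]
      constructor
      · rintro ⟨hx, hxy⟩
        exact ⟨⟨hx, hxy.symm⟩, x, hx, hxy⟩
      · rintro ⟨⟨hx, hxy⟩, -⟩
        exact ⟨hx, hxy.symm⟩
    have h3 : ∀ y ∈ T, ∑ x ∈ S with x ∈ neighbors y, conductance x y * f y ≤
        (2 ^ k) ^ 2 * (f y * mass ε k y) := by
      intro y _
      have h5 : (2 ^ k) ^ 2 * (f y * mass ε k y) = ∑ x ∈ neighbors y, conductance x y * f y := by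
        rw [← Finset.sum_mul]
        simp only [conductance_comm _ y]
        rw [sum_conductance]
        ring
      rw [h5]
      refine Finset.sum_le_sum_of_subset_of_nonneg (fun x hx => (Finset.mem_filter.1 hx).2)
        fun x _ _ => mul_nonneg (conductance_pos _ _).le (hf.1 y)
    have h4 := Finset.sum_le_sum h3
    rw [← Finset.mul_sum] at h4
    rw [h1, h2]
    calc _ ≤ mesh k ^ 2 * ((2 ^ k) ^ 2 * M) := by
          refine mul_le_mul_of_nonneg_left (h4.trans ?_) (sq_nonneg _)
          exact mul_le_mul_of_nonneg_left (hf.2 T) (by positivity)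
      _ = (mesh k * 2 ^ k) ^ 2 * M := by ring
      _ = M := by rw [mesh_mul_two_pow]; ring

lemma IsSubDensity.walk_pow {M : ℝ} {f : L2 ε k} (hf : IsSubDensity M f) (j : ℕ) :
    IsSubDensity M ((VaryingDim.walk ε k ^ j) f) := by
  induction j with
  | zero => simpa using hf
  | succ j ih => rw [pow_succ']; exact ih.walk

/-- Uniformization: tL = c·walk - c with c = t4^k, and the two summands commute. -/
lemma semigroup_eq_exp_walk (t : ℝ) :
    semigroup ε k t = Real.exp (-(t * (2 ^ k) ^ 2)) •
      NormedSpace.exp ((t * (2 ^ k) ^ 2) • walk ε k) := by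
  let _ : NormedAlgebra ℚ (L2 ε k →L[ℝ] L2 ε k) := NormedAlgebra.restrictScalars ℚ ℝ _
  set c := t * (2 ^ k) ^ 2 with hc
  have h1 : t • generator ε k = c • walk ε k + (-c) • (1 : L2 ε k →L[ℝ] L2 ε k) := by
    have : c * mesh k ^ 2 = t := by
      have : c * mesh k ^ 2 = t * (mesh k * 2 ^ k) ^ 2 := by rw [hc]; ring
      rw [this, mesh_mul_two_pow]; ring
    rw [walk, smul_add, smul_smul, this, neg_smul]
    abel
  have h2 : NormedSpace.exp ((-c) • (1 : L2 ε k →L[ℝ] L2 ε k)) =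
      Real.exp (-c) • (1 : L2 ε k →L[ℝ] L2 ε k) := by
    have := NormedSpace.algebraMap_exp_comm (𝕂 := ℝ) (𝔸 := L2 ε k →L[ℝ] L2 ε k) (-c)
    rw [Algebra.algebraMap_eq_smul_one, Algebra.algebraMap_eq_smul_one] at this
    rw [← this, Real.exp_eq_exp_ℝ]
  rw [semigroup, h1, NormedSpace.exp_add_of_commute ((Commute.one_right _).smul_right _), h2,
    mul_smul_comm, mul_one]

lemma IsSubDensity.semigroup {M : ℝ} {f : L2 ε k} (hf : IsSubDensity M f) {t : ℝ} (ht : 0 ≤ t) :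
    IsSubDensity M (semigroup ε k t f) := by
  set c := t * (2 ^ k) ^ 2 with hc
  have hc0 : 0 ≤ c := by positivity
  have hS : VaryingDim.semigroup ε k t f =
      Real.exp (-c) • NormedSpace.exp (c • VaryingDim.walk ε k) f := by
    rw [semigroup_eq_exp_walk]; rfl
  have hcoef : ∀ j : ℕ, 0 ≤ (j.factorial : ℝ)⁻¹ * c ^ j := fun j => by positivity
  constructor
  · intro x
    have h := hasSum_exp_smul_apply (VaryingDim.walk ε k) (innerSL ℝ (delta x)) f c
    rw [hS, coe_smul, ← inner_delta]
    refine mul_nonneg (Real.exp_pos _).le (h.nonneg fun j => mul_nonneg (hcoef j) ?_)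
    rw [innerSL_apply_apply, inner_delta]
    exact (hf.walk_pow j).1 x
  · intro S
    let l : L2 ε k →L[ℝ] ℝ := ∑ x ∈ S, mass ε k x • innerSL ℝ (delta x)
    have hl : ∀ g : L2 ε k, l g = ∑ x ∈ S, g x * mass ε k x := by
      intro g
      simp [l, inner_delta, mul_comm]
    have h := hasSum_exp_smul_apply (VaryingDim.walk ε k) l f c
    have he := NormedSpace.exp_series_hasSum_exp' (𝕂 := ℝ) c
    rw [← Real.exp_eq_exp_ℝ] at he
    have hle := hasSum_le (fun j => ?_) h (he.mul_right M)
    · rw [hS, ← hl, map_smul, smul_eq_mul]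
      calc _ ≤ Real.exp (-c) * (Real.exp c * M) :=
            mul_le_mul_of_nonneg_left hle (Real.exp_pos _).le
        _ = M := by rw [← mul_assoc, ← Real.exp_add]; simp
    · rw [hl, smul_eq_mul]
      exact mul_le_mul_of_nonneg_left ((hf.walk_pow j).2 S) (hcoef j)

lemma isSubDensity_delta (x : Vertex ε k) : IsSubDensity 1 (delta x) := by
  classical
  have hx : delta x x * mass ε k x = 1 := by
    rw [delta_apply_self, inv_mul_cancel₀ (mass_pos ε k x).ne']
  constructor
  · intro y
    by_cases h : y = x
    · rw [h, delta_apply_self]; exact (inv_pos.2 (mass_pos ε k x)).le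
    · rw [delta_apply_ne h]
  · intro S
    have h0 : ∀ y, y ≠ x → delta x y * mass ε k y = 0 := fun y hy => by
      rw [delta_apply_ne hy, zero_mul]
    by_cases h : x ∈ S
    · rw [Finset.sum_eq_single_of_mem x h fun y _ hy => h0 y hy, hx]
    · rw [Finset.sum_eq_zero fun y hy => h0 y fun e => h (e ▸ hy)]
      exact zero_le_one

/-! ### Growth of weighted norms -/

lemma memLp_mul {w : Vertex ε k → ℝ} {B : ℝ} (hw : ∀ x, |w x| ≤ B) (f : L2 ε k) :
    MemLp (fun x => w x * f x) 2 (refMeasure ε k) :=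
  MemLp.of_le_mul (c := B) (Lp.memLp f) Measurable.of_discrete.aestronglyMeasurable
    (Filter.Eventually.of_forall fun x => by
      rw [norm_mul]; exact mul_le_mul_of_nonneg_right (hw x) (norm_nonneg _))

/-- Multiplication by a bounded function. -/
noncomputable def mulOp (w : Vertex ε k → ℝ) (B : ℝ) (hw : ∀ x, |w x| ≤ B) :
    L2 ε k →L[ℝ] L2 ε k :=
  LinearMap.mkContinuous
    { toFun := fun f => MemLp.toLp _ (memLp_mul hw f)
      map_add' := fun f g => by
        rw [← MemLp.toLp_add]
        refine MemLp.toLp_congr _ _ (Filter.Eventually.of_forall fun x => ?_)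
        simp only [coe_add, Pi.add_apply]; ring
      map_smul' := fun c f => by
        rw [← MemLp.toLp_const_smul]
        refine MemLp.toLp_congr _ _ (Filter.Eventually.of_forall fun x => ?_)
        simp only [coe_smul, Pi.smul_apply, smul_eq_mul, RingHom.id_apply]; ring }
    B fun f => by
      refine Lp.norm_le_mul_norm_of_ae_le_mul (Filter.Eventually.of_forall fun x => ?_)
      change ‖MemLp.toLp _ (memLp_mul hw f) x‖ ≤ _
      rw [coe_toLp, norm_mul]
      exact mul_le_mul_of_nonneg_right (hw x) (norm_nonneg _)

lemma mulOp_apply {w : Vertex ε k → ℝ} {B : ℝ} (hw : ∀ x, |w x| ≤ B) (f : L2 ε k)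
    (x : Vertex ε k) : mulOp w B hw f x = w x * f x :=
  coe_toLp (memLp_mul hw f) x

lemma tsum_conductance_snd {F : Vertex ε k → ℝ} (hF : ∀ x, 0 ≤ F x)
    (hs : Summable fun x => F x * mass ε k x) :
    (Summable fun e : (graph ε k).Dart => conductance e.fst e.snd * F e.snd) ∧
      ∑' e : (graph ε k).Dart, conductance e.fst e.snd * F e.snd =
        (2 ^ k) ^ 2 * ∑' x, F x * mass ε k x := by
  obtain ⟨h1, h2⟩ := tsum_conductance_fst hF hs
  let σ : (graph ε k).Dart ≃ (graph ε k).Dart :=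
    Function.Involutive.toPerm _ SimpleGraph.Dart.symm_involutive
  have he : (fun e : (graph ε k).Dart => conductance e.fst e.snd * F e.snd) ∘ σ =
      fun e : (graph ε k).Dart => conductance e.fst e.snd * F e.fst := by
    funext e
    change conductance e.snd e.fst * F e.fst = _
    rw [conductance_comm]
  rw [← h2, ← he]
  exact ⟨σ.summable_iff.1 (he ▸ h1), (σ.tsum_eq _).symm⟩

lemma tsum_conductance_add_sq (f : L2 ε k) :
    (Summable fun e : (graph ε k).Dart => conductance e.fst e.snd * (f e.fst ^ 2 + f e.snd ^ 2)) ∧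
      ∑' e : (graph ε k).Dart, conductance e.fst e.snd * (f e.fst ^ 2 + f e.snd ^ 2) =
        2 * (2 ^ k) ^ 2 * ‖f‖ ^ 2 := by
  obtain ⟨h1, h2⟩ := tsum_conductance_fst (fun x => sq_nonneg (f x)) (summable_sq_mass f)
  obtain ⟨h3, h4⟩ := tsum_conductance_snd (fun x => sq_nonneg (f x)) (summable_sq_mass f)
  simp only [mul_add]
  refine ⟨h1.add h3, ?_⟩
  rw [h1.tsum_add h3, h2, h4, norm_sq_eq_tsum]
  ring

lemma cosh_le_one_add_sq {b : ℝ} (hb : |b| ≤ 1) : Real.cosh b ≤ 1 + b ^ 2 := by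
  have hb2 : b ^ 2 ≤ 1 := (sq_le_one_iff_abs_le_one b).2 hb
  have h := Real.add_one_le_exp (-(b ^ 2 / 2))
  have h1 : Real.exp (b ^ 2 / 2) * Real.exp (-(b ^ 2 / 2)) = 1 := by
    rw [← Real.exp_add]; simp
  have h2 := Real.exp_pos (b ^ 2 / 2)
  refine (Real.cosh_le_exp_half_sq b).trans ?_
  -- (1 + b²)(1 - b²/2) ≥ 1 when b² ≤ 1, while e^{-b²/2} ≥ 1 - b²/2.
  nlinarith [sq_nonneg b]

/-- With A = e^p a and B = e^q c the left side equals 2cosh(p-q)AB - A² - B², at most (cosh(p-q) -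
1)(A² + B²). The gradient term has been discarded: only the excess of cosh over 1 remains. -/
lemma neg_mul_weighted_sub_le {p q a c b : ℝ} (hb : b ≤ 1) (hpq : |p - q| ≤ b) :
    -((a - c) * (Real.exp p * (Real.exp p * a) - Real.exp q * (Real.exp q * c))) ≤
      b ^ 2 * ((Real.exp p * a) ^ 2 + (Real.exp q * c) ^ 2) := by
  have hc : Real.cosh (p - q) ≤ 1 + b ^ 2 := by
    refine (cosh_le_one_add_sq (hpq.trans hb)).trans ?_
    have := sq_le_sq' (by linarith [abs_nonneg (p - q), (abs_le.1 hpq).1]) (abs_le.1 hpq).2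
    linarith
  have h1 : Real.exp p * Real.exp p =
      Real.exp p * Real.exp q * Real.exp (p - q) := by
    rw [← Real.exp_add, ← Real.exp_add, ← Real.exp_add]; congr 1; ring
  have h2 : Real.exp q * Real.exp q =
      Real.exp p * Real.exp q * Real.exp (-(p - q)) := by
    rw [← Real.exp_add, ← Real.exp_add, ← Real.exp_add]; congr 1; ring
  set A := Real.exp p * a with hA
  set B := Real.exp q * c with hB
  have h3 : -((a - c) * (Real.exp p * A - Real.exp q * B)) =
      -A ^ 2 - B ^ 2 + 2 * Real.cosh (p - q) * (A * B) := by
    have h4 : -((a - c) * (Real.exp p * A - Real.exp q * B)) =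
      -A ^ 2 - B ^ 2 + (Real.exp p * Real.exp p + Real.exp q * Real.exp q) * (a * c) := by
      rw [hA, hB]; ring
    rw [h4, h1, h2, Real.cosh_eq, hA, hB]
    ring
  rw [h3]
  have h5 : 2 * (A * B) ≤ A ^ 2 + B ^ 2 := by nlinarith [sq_nonneg (A - B)]
  have h6 := mul_le_mul_of_nonneg_left h5 (Real.cosh_pos (p - q)).le
  have h7 := mul_le_mul_of_nonneg_right hc (add_nonneg (sq_nonneg A) (sq_nonneg B))
  nlinarith

lemma inner_mulOp_comm {w : Vertex ε k → ℝ} {B : ℝ} (hw : ∀ x, |w x| ≤ B) (f g : L2 ε k) :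
    inner ℝ (mulOp w B hw f) g = inner ℝ f (mulOp w B hw g) := by
  simp only [inner_eq_tsum, mulOp_apply]
  exact tsum_congr fun x => by ring

lemma neg_energy_mulOp_le {ψ : Vertex ε k → ℝ} {B b : ℝ} (hw : ∀ x, |Real.exp (ψ x)| ≤ B)
    (hb : b ≤ 1) (hψ : ∀ x y, (graph ε k).Adj x y → |ψ x - ψ y| ≤ b) (f : L2 ε k) :
    -energy ε k f (mulOp _ B hw (mulOp _ B hw f) : L2 ε k) ≤
      b ^ 2 * (2 ^ k) ^ 2 * ‖mulOp _ B hw f‖ ^ 2 := by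
  obtain ⟨h1, h2⟩ := tsum_conductance_add_sq (mulOp _ B hw f)
  have hs := summable_conductance_grad_mul f (mulOp _ B hw (mulOp _ B hw f))
  have hle := hs.neg.tsum_le_tsum (fun e => ?_) (h1.mul_left (b ^ 2))
  · rw [tsum_neg, tsum_mul_left, h2] at hle
    rw [energy_eq_tsum]
    linarith
  · simp only [mulOp_apply]
    have := neg_mul_weighted_sub_le (a := f e.fst) (c := f e.snd) hb (hψ _ _ e.adj)
    have := mul_le_mul_of_nonneg_left this (conductance_pos e.fst e.snd).le
    linarith

/-- Grönwall: the derivative of the squared weighted norm of u = P_r f is -2ℰ(u, e^{2ψ}u), which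
`neg_energy_mulOp_le` bounds by 2(b2^k)² times that squared norm. -/
lemma norm_sq_mulOp_semigroup_le {ψ : Vertex ε k → ℝ} {B b : ℝ}
    (hw : ∀ x, |Real.exp (ψ x)| ≤ B) (hb : b ≤ 1)
    (hψ : ∀ x y, (graph ε k).Adj x y → |ψ x - ψ y| ≤ b) (f : L2 ε k) {s t : ℝ} (hst : s ≤ t) :
    ‖mulOp _ B hw (semigroup ε k t f)‖ ^ 2 ≤
      Real.exp (2 * (b * 2 ^ k) ^ 2 * (t - s)) * ‖mulOp _ B hw (semigroup ε k s f)‖ ^ 2 := by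
  set W := mulOp _ B hw
  set c : ℝ := 2 * (b * 2 ^ k) ^ 2 with hc
  have hd : ∀ r, HasDerivAt (fun r => Real.exp (-(c * r)) * ‖W (semigroup ε k r f)‖ ^ 2)
      (Real.exp (-(c * r)) * -c * ‖W (semigroup ε k r f)‖ ^ 2 + Real.exp (-(c * r)) *
        (2 * inner ℝ (W (semigroup ε k r f)) (W (generator ε k (semigroup ε k r f))))) r := by
    intro r
    have h1 : HasDerivAt (fun r => W (semigroup ε k r f))
        (W (generator ε k (semigroup ε k r f))) r :=
      W.hasFDerivAt.comp_hasDerivAt r (hasDerivAt_semigroup f r)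
    have h2 : HasDerivAt (fun r : ℝ => Real.exp (-(c * r))) (Real.exp (-(c * r)) * -c) r := by
      have h3 : HasDerivAt (fun r : ℝ => -(c * r)) (-c) r := by
        simpa using ((hasDerivAt_id r).const_mul c).fun_neg
      exact h3.exp
    exact h2.mul h1.norm_sq
  have hanti : Antitone fun r => Real.exp (-(c * r)) * ‖W (semigroup ε k r f)‖ ^ 2 := by
    refine antitone_of_deriv_nonpos (fun r => (hd r).differentiableAt) fun r => ?_
    rw [(hd r).deriv]
    have h1 := neg_energy_mulOp_le hw hb hψ (semigroup ε k r f)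
    rw [← inner_generator, real_inner_comm, inner_mulOp_comm] at h1
    have h2 : Real.exp (-(c * r)) * -c * ‖W (semigroup ε k r f)‖ ^ 2 + Real.exp (-(c * r)) *
        (2 * inner ℝ (W (semigroup ε k r f)) (W (generator ε k (semigroup ε k r f)))) =
      2 * Real.exp (-(c * r)) *
        (inner ℝ (W (semigroup ε k r f)) (W (generator ε k (semigroup ε k r f))) -
          b ^ 2 * (2 ^ k) ^ 2 * ‖W (semigroup ε k r f)‖ ^ 2) := by rw [hc]; ring
    rw [h2]
    exact mul_nonpos_of_nonneg_of_nonpos (by positivity) (by linarith)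
  have h := mul_le_mul_of_nonneg_left (hanti hst) (Real.exp_pos (c * t)).le
  simp only [← mul_assoc, ← Real.exp_add] at h
  rw [show c * t + -(c * t) = 0 by ring, Real.exp_zero, one_mul] at h
  rwa [mul_sub, sub_eq_add_neg]

/-! ### The differential inequality for the `L²` norm -/

lemma hasDerivAt_norm_sq_semigroup (f : L2 ε k) (t : ℝ) :
    HasDerivAt (fun t => ‖semigroup ε k t f‖ ^ 2)
      (-(2 * energy ε k (semigroup ε k t f) (semigroup ε k t f))) t := by
  refine (hasDerivAt_semigroup f t).norm_sq.congr_deriv ?_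
  rw [real_inner_comm, inner_generator]
  ring

/-- One of the two summands is at least ct/2. The case of N⁻² gives the factor √(2/c), at most 2/c
because c ≤ 2. -/
lemma le_max_of_mul_le_inv_add {N c t : ℝ} (hN : 0 < N) (hc : 0 < c) (hc1 : c ≤ 2) (ht : 0 < t)
    (h : c * t ≤ N⁻¹ + (N ^ 2)⁻¹) : N ≤ 2 / c * max (1 / t) (1 / √t) := by
  have hφ1 : 1 / t ≤ max (1 / t) (1 / √t) := le_max_left _ _
  have hφ2 : 1 / √t ≤ max (1 / t) (1 / √t) := le_max_right _ _
  have hst := Real.sqrt_pos.2 ht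
  have hsq := Real.sq_sqrt ht.le
  have h2c : 1 ≤ 2 / c := by rw [le_div_iff₀ hc]; linarith
  rcases le_or_gt (c * t / 2) N⁻¹ with h1 | h1
  · refine le_trans ?_ (mul_le_mul_of_nonneg_left hφ1 (by positivity))
    have := (le_inv_comm₀ (by positivity) hN).1 h1
    refine this.trans_eq ?_
    field_simp
  · have h3 : c * t / 2 ≤ (N ^ 2)⁻¹ := by linarith
    have h4 := (le_inv_comm₀ (by positivity) (by positivity)).1 h3
    refine le_trans ?_ (mul_le_mul_of_nonneg_left hφ2 (by positivity))
    refine (sq_le_sq₀ hN.le (by positivity)).1 ?_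
    refine h4.trans ?_
    rw [mul_pow, div_pow 1, one_pow, hsq]
    have : (c * t / 2)⁻¹ = 2 / c * (1 / t) := by field_simp
    rw [this]
    refine mul_le_mul_of_nonneg_right ?_ (by positivity)
    nlinarith

/-- For N = ‖P_t δ_x‖² one has (1/N)' = 2ℰ/N² and (1/N²)' = 4ℰ/N³. Both are nonnegative and at each
time one of them is at least c, so 1/N + 1/N² - ct is monotone whichever alternative holds. -/
lemma norm_sq_semigroup_le {c : ℝ} (hc : 0 < c) (hc1 : c ≤ 2)
    (hnash : ∀ f : L2 ε k, IsSubDensity 1 f →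
      c * ‖f‖ ^ 4 ≤ 2 * energy ε k f f ∨ c * ‖f‖ ^ 6 ≤ 4 * energy ε k f f)
    (x : Vertex ε k) {t : ℝ} (ht : 0 < t) :
    ‖semigroup ε k t (delta x)‖ ^ 2 ≤ 2 / c * max (1 / t) (1 / √t) := by
  have hx : (delta x : L2 ε k) ≠ 0 := by
    intro h
    have := norm_delta_sq x
    rw [h, norm_zero] at this
    have := inv_pos.2 (mass_pos ε k x)
    linarith
  set N : ℝ → ℝ := fun t => ‖semigroup ε k t (delta x)‖ ^ 2 with hNdef
  have hN : ∀ t, 0 < N t := fun t => pow_pos (norm_pos_iff.2 (semigroup_ne_zero hx t)) 2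
  let E : ℝ → ℝ := fun t => energy ε k (semigroup ε k t (delta x)) (semigroup ε k t (delta x))
  have hd : ∀ t, HasDerivAt N (-(2 * E t)) t := hasDerivAt_norm_sq_semigroup (delta x)
  have hG : ∀ t, HasDerivAt (fun t => (N t)⁻¹ + (N t ^ 2)⁻¹ - c * t)
      (2 * E t / N t ^ 2 + 4 * E t / N t ^ 3 - c) t := by
    intro t
    have h1 := (hd t).inv (hN t).ne'
    have h2 := ((hd t).pow 2).inv (pow_pos (hN t) 2).ne'
    have h3 : HasDerivAt (fun t : ℝ => c * t) c t := by
      simpa using (hasDerivAt_id t).const_mul c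
    refine ((h1.add h2).sub h3).congr_deriv ?_
    have := (hN t).ne'
    simp only [Pi.pow_apply]
    generalize N t = a at this
    field_simp
    ring
  have hmono : MonotoneOn (fun t => (N t)⁻¹ + (N t ^ 2)⁻¹ - c * t) (Set.Ici 0) := by
    refine monotoneOn_of_deriv_nonneg (convex_Ici 0)
      (fun t _ => (hG t).continuousAt.continuousWithinAt)
      (fun t _ => (hG t).differentiableAt.differentiableWithinAt) fun t ht => ?_
    rw [interior_Ici] at ht
    rw [(hG t).deriv]
    have hE : 0 ≤ E t := energy_nonneg _ _ _
    have hNt := hN t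
    have h0 : 0 ≤ 2 * E t / N t ^ 2 := by positivity
    have h0' : 0 ≤ 4 * E t / N t ^ 3 := by positivity
    rcases hnash _ ((isSubDensity_delta x).semigroup (le_of_lt ht)) with h | h
    · have : c ≤ 2 * E t / N t ^ 2 := by
        rw [le_div_iff₀ (by positivity)]
        refine le_trans (le_of_eq ?_) h
        simp only [hNdef]; ring
      linarith
    · have : c ≤ 4 * E t / N t ^ 3 := by
        rw [le_div_iff₀ (by positivity)]
        refine le_trans (le_of_eq ?_) h
        simp only [hNdef]; ring
      linarith
  have h := hmono (Set.self_mem_Ici) ht.le ht.le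
  have h0 : 0 < (N 0)⁻¹ + (N 0 ^ 2)⁻¹ := by
    have := hN 0
    positivity
  refine le_max_of_mul_le_inv_add (hN t) hc hc1 ht ?_
  simp only [mul_zero, sub_zero] at h
  linarith

/-! ### Geometry of the lattice outside the disc -/

lemma norm_sq_latticePoint (z : ℤ × ℤ) :
    ‖latticePoint k z‖ ^ 2 = mesh k ^ 2 * ((z.1 : ℝ) ^ 2 + (z.2 : ℝ) ^ 2) := by
  rw [EuclideanSpace.norm_sq_eq]
  simp [latticePoint, Fin.sum_univ_two]
  ring

lemma dist_sq_latticePoint (z w : ℤ × ℤ) :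
    dist (latticePoint k z) (latticePoint k w) ^ 2 =
      mesh k ^ 2 * (((z.1 - w.1 : ℤ) : ℝ) ^ 2 + ((z.2 - w.2 : ℤ) : ℝ) ^ 2) := by
  rw [EuclideanSpace.dist_eq, Real.sq_sqrt (by positivity)]
  simp [latticePoint, Fin.sum_univ_two, Real.dist_eq, sq_abs]
  ring

lemma mem_disc_iff (hε : 0 ≤ ε) (z : ℤ × ℤ) :
    latticePoint k z ∈ disc ε ↔ mesh k ^ 2 * ((z.1 : ℝ) ^ 2 + (z.2 : ℝ) ^ 2) ≤ ε ^ 2 := by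
  rw [disc, mem_closedBall_zero_iff, ← norm_sq_latticePoint, sq_le_sq₀ (norm_nonneg _) hε]

lemma dist_latticePoint_eq_mesh_iff (z w : ℤ × ℤ) :
    dist (latticePoint k z) (latticePoint k w) = mesh k ↔
      (z.1 - w.1) ^ 2 + (z.2 - w.2) ^ 2 = 1 := by
  rw [← sq_eq_sq₀ dist_nonneg (mesh_pos k).le, dist_sq_latticePoint]
  have := pow_pos (mesh_pos k) 2
  rw [mul_eq_left₀ this.ne']
  exact_mod_cast Iff.rfl

/-- Moving from z in a direction with nonnegative radial component never decreases the norm. -/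
lemma disjoint_segment_of_inner_nonneg {z e : ℤ × ℤ} (hz : latticePoint k z ∉ disc ε)
    (h : 0 ≤ z.1 * e.1 + z.2 * e.2) :
    Disjoint (segment ℝ (latticePoint k z) (latticePoint k (z + e))) (disc ε) := by
  rw [Set.disjoint_left]
  rintro p ⟨a, b, ha, hb, hab, rfl⟩ hp
  apply hz
  rw [disc, mem_closedBall_zero_iff] at hp ⊢
  refine le_trans ?_ hp
  obtain rfl : a = 1 - b := by linarith
  rw [← sq_le_sq₀ (norm_nonneg _) (norm_nonneg _), norm_sq_latticePoint,
    EuclideanSpace.norm_sq_eq]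
  have h' : (0 : ℝ) ≤ (z.1 : ℝ) * e.1 + (z.2 : ℝ) * e.2 := by exact_mod_cast h
  have e1 : ∀ c d : ℝ, (1 - b) * (mesh k * c) + b * (mesh k * (c + d)) = mesh k * (c + b * d) :=
    fun c d => by ring
  simp [latticePoint, Fin.sum_univ_two, e1, mul_pow]
  rw [← mul_add]
  refine mul_le_mul_of_nonneg_left ?_ (sq_nonneg _)
  nlinarith [mul_nonneg hb h', sq_nonneg (b * e.1), sq_nonneg (b * e.2)]

lemma adj_plane {z w : ℤ × ℤ} (hz : latticePoint k z ∉ disc ε) (hw : latticePoint k w ∉ disc ε)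
    (h : (z.1 - w.1) ^ 2 + (z.2 - w.2) ^ 2 = 1) :
    (graph ε k).Adj (.plane z hz) (.plane w hw) := by
  refine ⟨(dist_latticePoint_eq_mesh_iff z w).2 h, ?_⟩
  rcases le_or_gt 0 (z.1 * (w - z).1 + z.2 * (w - z).2) with h0 | h0
  · have := disjoint_segment_of_inner_nonneg hz h0
    rwa [add_sub_cancel] at this
  -- Integrality matters: z·(w-z) < 0 means z·(w-z) ≤ -1, and w·(z-w) = -z·(w-z) - |w-z|² with
  -- |w-z|² = 1. So one of the two directions of a lattice edge always points outward.
  · have h1 : 0 ≤ w.1 * (z - w).1 + w.2 * (z - w).2 := by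
      simp only [Prod.fst_sub, Prod.snd_sub] at h0 ⊢
      nlinarith
    have := disjoint_segment_of_inner_nonneg hw h1
    rwa [add_sub_cancel, segment_symm] at this

lemma adj_plane_star {z w : ℤ × ℤ} (hz : latticePoint k z ∉ disc ε) (hw : latticePoint k w ∈ disc ε)
    (h : (z.1 - w.1) ^ 2 + (z.2 - w.2) ^ 2 = 1) :
    (graph ε k).Adj (.plane z hz) .star :=
  ⟨w, hw, (dist_latticePoint_eq_mesh_iff z w).2 h⟩

lemma exists_step_toward_zero {z : ℤ × ℤ} (hz : z ≠ 0) :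
    ∃ w : ℤ × ℤ, (z.1 - w.1) ^ 2 + (z.2 - w.2) ^ 2 = 1 ∧
      w.1.natAbs + w.2.natAbs < z.1.natAbs + z.2.natAbs := by
  obtain ⟨a, b⟩ := z
  rcases lt_trichotomy a 0 with h | h | h
  · exact ⟨(a + 1, b), by ring, by simp only; omega⟩
  · rcases lt_trichotomy b 0 with h' | h' | h'
    · exact ⟨(a, b + 1), by ring, by simp only; omega⟩
    · exact absurd (by rw [h, h']; rfl) hz
    · exact ⟨(a, b - 1), by ring, by simp only; omega⟩
  · exact ⟨(a - 1, b), by ring, by simp only; omega⟩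

lemma zero_mem_disc (hε : 0 ≤ ε) : latticePoint k 0 ∈ disc ε := by
  rw [mem_disc_iff hε]; simp; positivity

/-- Connectedness is what makes the triangle inequality available for the graph distance, whose
value is 0 between unreachable vertices. Planar points descend in ℓ¹ norm until they enter the disc.
-/
lemma reachable_star (hε : 0 ≤ ε) (x : Vertex ε k) : (graph ε k).Reachable x .star := by
  have hplane : ∀ (n : ℕ) (z : ℤ × ℤ) (hz : latticePoint k z ∉ disc ε),
      z.1.natAbs + z.2.natAbs ≤ n → (graph ε k).Reachable (.plane z hz) .star := by
    intro n
    induction n with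
    | zero =>
      intro z hz h
      have : z = 0 := Prod.ext (by simp; omega) (by simp; omega)
      exact absurd (this ▸ zero_mem_disc hε) hz
    | succ n ih =>
      intro z hz h
      have hz0 : z ≠ 0 := by rintro rfl; exact hz (zero_mem_disc hε)
      obtain ⟨w, hw1, hw2⟩ := exists_step_toward_zero hz0
      by_cases hw : latticePoint k w ∈ disc ε
      · exact (adj_plane_star hz hw hw1).reachable
      · exact (adj_plane hz hw hw1).reachable.trans (ih w hw (by omega))
  rcases x with _ | n | ⟨z, hz⟩
  · rfl
  · induction n using PNat.recOn with
    | one => exact SimpleGraph.Adj.reachable (show Adj ε k (.line 1) .star from rfl)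
    | succ n ih =>
      exact (SimpleGraph.Adj.reachable
        (show Adj ε k (.line (n + 1)) (.line n) from Or.inr rfl)).trans ih
  · exact hplane _ z hz le_rfl

lemma graph_connected (hε : 0 ≤ ε) : (graph ε k).Connected where
  preconnected x y := (reachable_star hε x).trans (reachable_star hε y).symm
  nonempty := ⟨.star⟩

/-! ### From on-diagonal to off-diagonal bounds -/

/-- The logarithm of the weight: a multiple of the truncated distance from `x`. -/
noncomputable def logWeight (x : Vertex ε k) (R : ℕ) (β : ℝ) (z : Vertex ε k) : ℝ :=
  β * mesh k * (min ((graph ε k).dist x z) R : ℕ)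

/-- The truncation at R keeps the weight bounded on the infinite graph, so that it acts on `L2`. -/
lemma abs_exp_logWeight_le (x : Vertex ε k) (R : ℕ) (β : ℝ) (z : Vertex ε k) :
    |Real.exp (logWeight x R β z)| ≤ Real.exp (|β| * mesh k * R) := by
  have hm := mesh_pos k
  rw [abs_of_pos (Real.exp_pos _), Real.exp_le_exp, logWeight]
  have h1 : ((min ((graph ε k).dist x z) R : ℕ) : ℝ) ≤ R := by exact_mod_cast min_le_right _ _
  calc _ ≤ |β| * mesh k * (min ((graph ε k).dist x z) R : ℕ) := by
        gcongr; exact le_abs_self β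
    _ ≤ _ := by gcongr

/-- Multiplication by the exponential weight. -/
noncomputable def weightOp (x : Vertex ε k) (R : ℕ) (β : ℝ) : L2 ε k →L[ℝ] L2 ε k :=
  mulOp _ _ (abs_exp_logWeight_le x R β)

lemma weightOp_apply (x : Vertex ε k) (R : ℕ) (β : ℝ) (f : L2 ε k) (z : Vertex ε k) :
    weightOp x R β f z = Real.exp (logWeight x R β z) * f z :=
  mulOp_apply _ f z

lemma L2_ext {f g : L2 ε k} (h : ∀ x, f x = g x) : f = g :=
  Lp.ext (Filter.Eventually.of_forall h)

lemma weightOp_weightOp (x : Vertex ε k) (R : ℕ) (β : ℝ) (f : L2 ε k) :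
    weightOp x R β (weightOp x R β f) = weightOp x R (2 * β) f := by
  refine L2_ext fun z => ?_
  simp only [weightOp_apply]
  rw [← mul_assoc, ← Real.exp_add]
  congr 2
  simp only [logWeight]; ring

lemma weightOp_delta (x : Vertex ε k) (R : ℕ) (β : ℝ) : weightOp x R β (delta x) = delta x := by
  refine L2_ext fun z => ?_
  rw [weightOp_apply]
  by_cases h : z = x
  · simp [h, logWeight]
  · rw [delta_apply_ne h, mul_zero]

lemma abs_logWeight_sub_le (x : Vertex ε k) (R : ℕ) {β : ℝ} (hβ : 0 ≤ β) {y z : Vertex ε k}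
    (h : (graph ε k).Adj y z) : |logWeight x R β y - logWeight x R β z| ≤ β * mesh k := by
  have hm := mesh_pos k
  have h1 : |((min ((graph ε k).dist x y) R : ℕ) : ℝ) - (min ((graph ε k).dist x z) R : ℕ)| ≤ 1 := by
    have h2 := h.diff_dist_adj (u := x)
    have h3 : min ((graph ε k).dist x y) R ≤ min ((graph ε k).dist x z) R + 1 := by omega
    have h4 : min ((graph ε k).dist x z) R ≤ min ((graph ε k).dist x y) R + 1 := by omega
    have h3' : ((min ((graph ε k).dist x y) R : ℕ) : ℝ) ≤ (min ((graph ε k).dist x z) R : ℕ) + 1 := by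
      exact_mod_cast h3
    have h4' : ((min ((graph ε k).dist x z) R : ℕ) : ℝ) ≤ (min ((graph ε k).dist x y) R : ℕ) + 1 := by
      exact_mod_cast h4
    rw [abs_le]; constructor <;> linarith
  rw [logWeight, logWeight, ← mul_sub, abs_mul, abs_of_nonneg (by positivity : 0 ≤ β * mesh k)]
  exact mul_le_of_le_one_right (by positivity) h1

/-- One edge changes the log-weight by at most b = β2^{-k}; thus b ≤ 1 means β ≤ 2^k, and b2^k = β
makes the growth rate independent of k. -/
lemma norm_sq_weightOp_semigroup_le (x : Vertex ε k) (R : ℕ) {β : ℝ} (hβ : 0 ≤ β)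
    (hβ' : β ≤ 2 ^ k) (f : L2 ε k) {s t : ℝ} (hst : s ≤ t) :
    ‖weightOp x R β (semigroup ε k t f)‖ ^ 2 ≤
      Real.exp (2 * β ^ 2 * (t - s)) * ‖weightOp x R β (semigroup ε k s f)‖ ^ 2 := by
  have hm := mesh_mul_two_pow k
  have h := norm_sq_mulOp_semigroup_le (abs_exp_logWeight_le x R β) (b := β * mesh k)
    (by rw [← hm, mul_comm]; exact mul_le_mul_of_nonneg_left hβ' (mesh_pos k).le)
    (fun y z hyz => abs_logWeight_sub_le x R hβ hyz) f hst
  rwa [mul_assoc β, hm, mul_one] at h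

lemma norm_weightOp_pow_four_le (x : Vertex ε k) (R : ℕ) (β : ℝ) (f : L2 ε k) :
    (‖weightOp x R β f‖ ^ 2) ^ 2 ≤ ‖weightOp x R (2 * β) f‖ ^ 2 * ‖f‖ ^ 2 := by
  rw [← mul_pow]
  refine pow_le_pow_left₀ (by positivity) ?_ 2
  rw [← real_inner_self_eq_norm_sq, ← weightOp_weightOp]
  have : inner ℝ (weightOp x R β f) (weightOp x R β f) =
      inner ℝ (weightOp x R β (weightOp x R β f)) f :=
    (inner_mulOp_comm (abs_exp_logWeight_le x R β) (weightOp x R β f) f).symm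
  rw [this]
  exact real_inner_le_norm _ _

lemma timeScale_div_le {s c : ℝ} (hs : 0 < s) (hc : 1 ≤ c) :
    max (1 / (s / c)) (1 / √(s / c)) ≤ c * max (1 / s) (1 / √s) := by
  have hc0 : 0 < c := by linarith
  rw [mul_max_of_nonneg _ _ hc0.le]
  refine max_le_max (le_of_eq (by field_simp)) ?_
  rw [Real.sqrt_div hs.le, one_div_div, mul_one_div]
  have := Real.sqrt_pos.2 hs
  gcongr
  exact Real.sqrt_le_iff.2 ⟨hc0.le, by nlinarith⟩

lemma timeScale_pos {s : ℝ} (hs : 0 < s) : 0 < max (1 / s) (1 / √s) :=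
  lt_max_of_lt_left (by positivity)

lemma inv_mass_le (x : Vertex ε k) : (mass ε k x)⁻¹ ≤ 4 * (2 ^ k) ^ 2 := by
  have h := (one_le_degree ε k x).trans (degree_le_mass ε k x)
  rw [inv_le_iff_one_le_mul₀ (mass_pos ε k x)]
  linarith

/-- Here j counts the doublings needed to bring β into [2^{k-1}, 2^k]. The bound reproduces itself
under (β, s) → (2β, s/4): the time scale loses a factor 4 in each Cauchy–Schwarz factor, and
16A·4·A·4 = (16A)², which dictates the constant 16. -/
lemma norm_sq_weightOp_semigroup_delta_le {A : ℝ}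
    (hdiag : ∀ (x : Vertex ε k) (s : ℝ), 0 < s →
      ‖semigroup ε k s (delta x)‖ ^ 2 ≤ A * max (1 / s) (1 / √s))
    (hA : 1 ≤ A) (j : ℕ) : ∀ {β : ℝ}, 0 < β → 2 ^ k / 2 ≤ 2 ^ j * β → 2 ^ j * β ≤ 2 ^ k →
      ∀ (x : Vertex ε k) (R : ℕ) {s : ℝ}, 0 < s →
      ‖weightOp x R β (semigroup ε k s (delta x))‖ ^ 2 ≤
        16 * A * max (1 / s) (1 / √s) * Real.exp (3 * β ^ 2 * s) := by
  induction j with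
  | zero =>
    intro β hβ h1 h2 x R s hs
    rw [pow_zero, one_mul] at h1 h2
    have h := norm_sq_weightOp_semigroup_le x R hβ.le h2 (delta x) hs.le
    rw [semigroup_zero, sub_zero,
      show (1 : L2 ε k →L[ℝ] L2 ε k) (delta x) = delta x from rfl, weightOp_delta, norm_delta_sq] at h
    -- At the top slope 2^k ≤ 2β, so 1/m_k(x) ≤ 4·4^k ≤ 16β²; then β² ≤ e^{β²s}/s produces the time
    -- factor.
    have h3 : (mass ε k x)⁻¹ ≤ 16 * β ^ 2 := by
      refine (inv_mass_le x).trans ?_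
      nlinarith [pow_pos (two_pos (α := ℝ)) k]
    have h4 : β ^ 2 * s ≤ Real.exp (β ^ 2 * s) := by
      linarith [Real.add_one_le_exp (β ^ 2 * s)]
    have h5 : 16 * β ^ 2 ≤ 16 * max (1 / s) (1 / √s) * Real.exp (β ^ 2 * s) := by
      calc 16 * β ^ 2 = 16 * (1 / s) * (β ^ 2 * s) := by field_simp
        _ ≤ _ := by gcongr; exact le_max_left _ _
    calc _ ≤ Real.exp (2 * β ^ 2 * s) * (16 * max (1 / s) (1 / √s) * Real.exp (β ^ 2 * s)) :=
          h.trans (mul_le_mul_of_nonneg_left (h3.trans h5) (Real.exp_pos _).le)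
      _ = 16 * 1 * max (1 / s) (1 / √s) * (Real.exp (2 * β ^ 2 * s) * Real.exp (β ^ 2 * s)) := by
          ring
      _ = 16 * 1 * max (1 / s) (1 / √s) * Real.exp (3 * β ^ 2 * s) := by
          rw [← Real.exp_add]; congr 2; ring
      _ ≤ _ := by
          have := timeScale_pos hs
          gcongr
  | succ j ih =>
    intro β hβ h1 h2 x R s hs
    have hβk : β ≤ 2 ^ k := by
      refine le_trans ?_ h2
      exact le_mul_of_one_le_left hβ.le (one_le_pow₀ (by norm_num))
    have hs4 : 0 < s / 4 := by positivity
    have hu := norm_sq_weightOp_semigroup_le x R hβ.le hβk (delta x)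
      (show s / 4 ≤ s by linarith)
    have hcs := norm_weightOp_pow_four_le x R β (semigroup ε k (s / 4) (delta x))
    have hi := ih (β := 2 * β) (by positivity) (by rw [← mul_assoc, ← pow_succ]; exact h1)
      (by rw [← mul_assoc, ← pow_succ]; exact h2) x R hs4
    have hd := hdiag x _ hs4
    have hφ := timeScale_div_le hs (show (1 : ℝ) ≤ 4 by norm_num)
    have hφ0 := timeScale_pos hs
    have hφ4 := timeScale_pos hs4
    set φ := max (1 / s) (1 / √s)
    set φ' := max (1 / (s / 4)) (1 / √(s / 4))
    refine (sq_le_sq₀ (by positivity) (by positivity)).1 ?_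
    calc (‖weightOp x R β (semigroup ε k s (delta x))‖ ^ 2) ^ 2
        ≤ (Real.exp (2 * β ^ 2 * (s - s / 4)) *
            ‖weightOp x R β (semigroup ε k (s / 4) (delta x))‖ ^ 2) ^ 2 := by gcongr
      _ = Real.exp (2 * β ^ 2 * (s - s / 4)) ^ 2 *
            (‖weightOp x R β (semigroup ε k (s / 4) (delta x))‖ ^ 2) ^ 2 := mul_pow _ _ _
      _ ≤ Real.exp (2 * β ^ 2 * (s - s / 4)) ^ 2 *
            ((16 * A * (4 * φ) * Real.exp (3 * (2 * β) ^ 2 * (s / 4))) * (A * (4 * φ))) := by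
          refine mul_le_mul_of_nonneg_left (hcs.trans ?_) (by positivity)
          refine mul_le_mul (hi.trans ?_) (hd.trans ?_) (by positivity) (by positivity) <;> gcongr
      _ = (16 * A * φ) ^ 2 * (Real.exp (2 * β ^ 2 * (s - s / 4)) ^ 2 *
            Real.exp (3 * (2 * β) ^ 2 * (s / 4))) := by ring
      -- The growth over [s/4, s] contributes 3β²s to the exponent after squaring, and the induction
      -- hypothesis another 3β²s.
      _ = (16 * A * φ * Real.exp (3 * β ^ 2 * s)) ^ 2 := by
          rw [mul_pow (16 * A * φ), ← Real.exp_nat_mul, ← Real.exp_nat_mul, ← Real.exp_add]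
          congr 2; push_cast; ring

lemma exists_pow_two_mul_mem {a β : ℝ} (hβ : 0 < β) (h : β ≤ a) :
    ∃ j : ℕ, a / 2 ≤ 2 ^ j * β ∧ 2 ^ j * β ≤ a := by
  obtain ⟨j, hj1, hj2⟩ := exists_nat_pow_near (one_le_div hβ |>.2 h) (one_lt_two (α := ℝ))
  rw [le_div_iff₀ hβ] at hj1
  rw [div_lt_iff₀ hβ, pow_succ] at hj2
  exact ⟨j, by linarith, hj1⟩

lemma heatKernel_eq_inner_half (t : ℝ) (x y : Vertex ε k) :
    heatKernel ε k t x y =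
      inner ℝ (semigroup ε k (t / 2) (delta x)) (semigroup ε k (t / 2) (delta y)) := by
  rw [heatKernel_eq, inner_semigroup, ← semigroup_add, add_halves]

/-- For α ≤ 0 the exponential factor is at least 1 and the diagonal bound suffices. For α > 0,
positivity of both half-time kernels allows e^{αd(x,y)} to be replaced pointwise by the product of
the weights centred at x and at y. -/
theorem heatKernel_le_of_diag (hε : 0 ≤ ε) {A : ℝ}
    (hdiag : ∀ (x : Vertex ε k) (s : ℝ), 0 < s →
      ‖semigroup ε k s (delta x)‖ ^ 2 ≤ A * max (1 / s) (1 / √s))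
    (hA : 1 ≤ A) {α : ℝ} (hα : α ≤ 2 ^ k / 2) {t : ℝ} (ht : 0 < t) (x y : Vertex ε k) :
    heatKernel ε k t x y ≤ 32 * A * max (1 / t) (1 / √t) *
      Real.exp (-α * graphDist ε k x y + 2 * t * α ^ 2) := by
  have ht2 : 0 < t / 2 := by positivity
  have hφ := timeScale_div_le ht (show (1 : ℝ) ≤ 2 by norm_num)
  have hφ0 := timeScale_pos ht
  have hm := mesh_pos k
  set φ := max (1 / t) (1 / √t)
  rw [heatKernel_eq_inner_half]
  set f := semigroup ε k (t / 2) (delta x) with hf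
  set g := semigroup ε k (t / 2) (delta y) with hg
  have hbound : ∀ a b B : ℝ, 0 ≤ a → 0 ≤ b → 0 ≤ B → a ^ 2 ≤ B → b ^ 2 ≤ B → a * b ≤ B := by
    intro a b B _ _ _ h1 h2
    nlinarith [sq_nonneg (a - b)]
  rcases le_or_gt α 0 with hα0 | hα0
  · have h1 : inner ℝ f g ≤ A * (2 * φ) := by
      refine (real_inner_le_norm f g).trans (hbound _ _ _ (norm_nonneg _) (norm_nonneg _)
        (by positivity) ((hdiag x _ ht2).trans ?_) ((hdiag y _ ht2).trans ?_)) <;> gcongr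
    refine h1.trans ?_
    have h2 : 1 ≤ Real.exp (-α * graphDist ε k x y + 2 * t * α ^ 2) := by
      refine Real.one_le_exp (add_nonneg (mul_nonneg (by linarith) ?_) (by positivity))
      unfold graphDist; positivity
    calc A * (2 * φ) ≤ 32 * A * φ * 1 := by nlinarith [mul_pos (show 0 < A by linarith) hφ0]
      _ ≤ _ := by gcongr
  · obtain ⟨j, hj1, hj2⟩ := exists_pow_two_mul_mem (a := 2 ^ k) hα0
      (by linarith [pow_pos (two_pos (α := ℝ)) k])
    -- The truncation level R = d(x,y) is harmless: if either minimum equals R, the truncated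
    -- triangle inequality below is immediate.
    set R := (graph ε k).dist x y with hR
    have hx := norm_sq_weightOp_semigroup_delta_le hdiag hA j hα0 hj1 hj2 x R ht2
    have hy := norm_sq_weightOp_semigroup_delta_le hdiag hA j hα0 hj1 hj2 y R ht2
    have hfd := (isSubDensity_delta x).semigroup ht2.le
    have hgd := (isSubDensity_delta y).semigroup ht2.le
    have h1 : Real.exp (α * graphDist ε k x y) * inner ℝ f g ≤
        inner ℝ (weightOp x R α f) (weightOp y R α g) := by
      rw [inner_eq_tsum, inner_eq_tsum, ← tsum_mul_left]
      have hsum : ∀ u v : L2 ε k, Summable fun z => u z * v z * mass ε k z := by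
        intro u v
        refine Summable.of_norm_bounded ((summable_sq_mass u).add (summable_sq_mass v)) fun z => ?_
        rw [norm_mul, Real.norm_of_nonneg (mass_pos ε k z).le, ← add_mul, Real.norm_eq_abs]
        refine mul_le_mul_of_nonneg_right ?_ (mass_pos ε k z).le
        rw [abs_le]
        constructor <;> nlinarith [sq_nonneg (u z + v z), sq_nonneg (u z - v z), sq_nonneg (u z),
          sq_nonneg (v z)]
      refine ((hsum f g).mul_left _).tsum_le_tsum (fun z => ?_) (hsum _ _)
      rw [weightOp_apply, weightOp_apply]
      have h2 : Real.exp (α * graphDist ε k x y) ≤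
          Real.exp (logWeight x R α z) * Real.exp (logWeight y R α z) := by
        rw [← Real.exp_add, Real.exp_le_exp]
        have h3 : R ≤ min ((graph ε k).dist x z) R + min ((graph ε k).dist y z) R := by
          have := (graph_connected (k := k) hε).dist_triangle (u := x) (v := z) (w := y)
          rw [SimpleGraph.dist_comm (u := z)] at this
          omega
        have h3' : (R : ℝ) ≤ (min ((graph ε k).dist x z) R : ℕ) +
          (min ((graph ε k).dist y z) R : ℕ) := by exact_mod_cast h3
        unfold graphDist logWeight
        rw [← mul_add, ← mul_assoc]
        exact mul_le_mul_of_nonneg_left h3' (by positivity)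
      have h4 : 0 ≤ f z * g z * mass ε k z :=
        mul_nonneg (mul_nonneg (hfd.1 z) (hgd.1 z)) (mass_pos ε k z).le
      calc _ ≤ _ := mul_le_mul_of_nonneg_right h2 h4
        _ = _ := by ring
    have h2 : inner ℝ (weightOp x R α f) (weightOp y R α g) ≤
        16 * A * (2 * φ) * Real.exp (3 * α ^ 2 * (t / 2)) := by
      refine (real_inner_le_norm _ _).trans (hbound _ _ _ (norm_nonneg _) (norm_nonneg _)
        (by positivity) (hx.trans ?_) (hy.trans ?_)) <;> gcongr
    have h3 := h1.trans h2
    rw [← le_div_iff₀' (Real.exp_pos _), mul_div_assoc, ← Real.exp_sub] at h3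
    refine h3.trans ?_
    calc _ = 32 * A * φ * Real.exp (3 * α ^ 2 * (t / 2) - α * graphDist ε k x y) := by ring
      -- The rate obtained at time t/2 is 3α²t/2, below the allowed 2α²t.
      _ ≤ _ := by
        gcongr
        nlinarith [mul_nonneg ht.le (sq_nonneg α)]

/-! ### Inequalities for sums -/

lemma tsum_mul_sq_le {ι : Type*} {u v : ι → ℝ} (hu : Summable fun i => u i ^ 2)
    (hv : Summable fun i => v i ^ 2) :
    (Summable fun i => u i * v i) ∧
      (∑' i, u i * v i) ^ 2 ≤ (∑' i, u i ^ 2) * ∑' i, v i ^ 2 := by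
  have huv : Summable fun i => u i * v i := by
    refine Summable.of_norm_bounded (hu.add hv) fun i => ?_
    rw [Real.norm_eq_abs, abs_le]
    constructor <;> nlinarith [sq_nonneg (u i + v i), sq_nonneg (u i - v i), sq_nonneg (u i),
      sq_nonneg (v i)]
  refine ⟨huv, ?_⟩
  have h : ∀ x : ℝ, 0 ≤ (∑' i, u i ^ 2) * (x * x) + (-(2 * ∑' i, u i * v i)) * x +
      ∑' i, v i ^ 2 := by
    intro x
    have h1 : ∑' i, (u i * x - v i) ^ 2 = ∑' i, (u i ^ 2 * (x * x) - u i * v i * (2 * x) + v i ^ 2) :=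
      tsum_congr fun i => by ring
    rw [((hu.mul_right (x * x)).sub (huv.mul_right (2 * x))).tsum_add hv,
      (hu.mul_right (x * x)).tsum_sub (huv.mul_right (2 * x)), tsum_mul_right, tsum_mul_right] at h1
    have h2 : 0 ≤ ∑' i, (u i * x - v i) ^ 2 := tsum_nonneg fun i => sq_nonneg _
    linarith
  have := discrim_le_zero h
  rw [discrim] at this
  nlinarith

/-- Telescoping to infinity, where a summable sequence vanishes. -/
lemma abs_zero_le_tsum_abs_sub {g : ℕ → ℝ} (hg : Summable g) :
    |g 0| ≤ ∑' i, |g (i + 1) - g i| := by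
  have hs : Summable fun i => |g (i + 1) - g i| :=
    (((summable_nat_add_iff 1).2 hg).sub hg).abs
  have hlim : Filter.Tendsto (fun N => |g N| + ∑' i, |g (i + 1) - g i|) Filter.atTop
      (nhds (|0| + ∑' i, |g (i + 1) - g i|)) :=
    (hg.tendsto_atTop_zero.abs).add_const _
  rw [abs_zero, zero_add] at hlim
  refine ge_of_tendsto' hlim fun N => ?_
  have h1 : g 0 = g N - ∑ i ∈ Finset.range N, (g (i + 1) - g i) := by
    rw [Finset.sum_range_sub]; ring
  calc |g 0| ≤ |g N| + |∑ i ∈ Finset.range N, (g (i + 1) - g i)| := by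
        nth_rewrite 1 [h1]; exact abs_sub _ _
    _ ≤ |g N| + ∑ i ∈ Finset.range N, |g (i + 1) - g i| := by
        gcongr; exact Finset.abs_sum_le_sum_abs _ _
    _ ≤ _ := by
        gcongr; exact hs.sum_le_tsum _ fun i _ => abs_nonneg _

lemma abs_le_tsum_abs_sub {g : ℤ → ℝ} (hg : Summable g) (a : ℤ) :
    |g a| ≤ ∑' i, |g (i + 1) - g i| := by
  have hinj : Function.Injective fun n : ℕ => a + n := fun m n h => by simpa using h
  have hs : Summable fun i => |g (i + 1) - g i| :=
    (((Equiv.addRight (1 : ℤ)).summable_iff.2 hg).sub hg).abs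
  have h := abs_zero_le_tsum_abs_sub (hg.comp_injective hinj)
  simp only [Function.comp, Nat.cast_zero, add_zero, Nat.cast_add, Nat.cast_one] at h
  refine h.trans ?_
  refine Summable.tsum_le_tsum_of_inj (fun n : ℕ => a + n) hinj (fun _ _ => abs_nonneg _)
    (fun n => ?_) ?_ hs
  · rw [add_assoc]
  · refine (hs.comp_injective hinj).congr fun n => ?_
    simp only [Function.comp, add_assoc]

/-- The Gagliardo–Nirenberg inequality on the planar lattice. -/
lemma tsum_sq_le_mul_tsum_abs_sub {g : ℤ × ℤ → ℝ} (hg : Summable g) :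
    (Summable fun z => g z ^ 2) ∧ ∑' z, g z ^ 2 ≤
      (∑' z : ℤ × ℤ, |g (z + (1, 0)) - g z|) * ∑' z : ℤ × ℤ, |g (z + (0, 1)) - g z| := by
  have hs1 : Summable fun z : ℤ × ℤ => |g (z + (1, 0)) - g z| :=
    (((Equiv.addRight ((1, 0) : ℤ × ℤ)).summable_iff.2 hg).sub hg).abs
  have hs2 : Summable fun z : ℤ × ℤ => |g (z + (0, 1)) - g z| :=
    (((Equiv.addRight ((0, 1) : ℤ × ℤ)).summable_iff.2 hg).sub hg).abs
  -- X is the total variation along a row and Y along a column. Each dominates |g| on its line, so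
  -- g(a,b)² ≤ Y(a)X(b), and the right side sums to a product.
  let X : ℤ → ℝ := fun b => ∑' a : ℤ, |g ((a, b) + (1, 0)) - g (a, b)|
  let Y : ℤ → ℝ := fun a => ∑' b : ℤ, |g ((a, b) + (0, 1)) - g (a, b)|
  have hs1' := (Equiv.prodComm ℤ ℤ).summable_iff.2 hs1
  have hX : Summable X := hs1'.prod
  have hY : Summable Y := hs2.prod
  have hX0 : ∀ b, 0 ≤ X b := fun b => tsum_nonneg fun _ => abs_nonneg _
  have hY0 : ∀ a, 0 ≤ Y a := fun a => tsum_nonneg fun _ => abs_nonneg _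
  have hXg : ∀ a b, |g (a, b)| ≤ X b := by
    intro a b
    have h := abs_le_tsum_abs_sub (g := fun a => g (a, b))
      (hg.comp_injective fun _ _ h => (Prod.mk.inj h).1) a
    simpa [X] using h
  have hYg : ∀ a b, |g (a, b)| ≤ Y a := by
    intro a b
    have h := abs_le_tsum_abs_sub (g := fun b => g (a, b))
      (hg.comp_injective fun _ _ h => (Prod.mk.inj h).2) b
    simpa [Y] using h
  have hYX : Summable fun z : ℤ × ℤ => Y z.1 * X z.2 := hY.mul_of_nonneg hX hY0 hX0
  have hle : ∀ z : ℤ × ℤ, g z ^ 2 ≤ Y z.1 * X z.2 := fun z => by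
    rw [← sq_abs, sq]
    exact mul_le_mul (hYg _ _) (hXg _ _) (abs_nonneg _) (hY0 _)
  have hsq := Summable.of_nonneg_of_le (fun z => sq_nonneg (g z)) hle hYX
  refine ⟨hsq, (hsq.tsum_le_tsum hle hYX).trans_eq ?_⟩
  have h1 : ∑' z : ℤ × ℤ, |g (z + (1, 0)) - g z| = ∑' b, X b := by
    rw [← (Equiv.prodComm ℤ ℤ).tsum_eq]
    exact hs1'.tsum_prod
  have h2 : ∑' z : ℤ × ℤ, |g (z + (0, 1)) - g z| = ∑' a, Y a := hs2.tsum_prod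
  rw [h1, h2, mul_comm, hY.tsum_mul_tsum hX hYX]

/-! ### Collapsing the disc -/

open Classical in
/-- The projection of the planar lattice to `E^k` that maps the disc to `a*_k`. -/
noncomputable def collapse (ε : ℝ) (k : ℕ) (z : ℤ × ℤ) : Vertex ε k :=
  if h : latticePoint k z ∈ disc ε then .star else .plane z h

lemma collapse_of_mem {z : ℤ × ℤ} (h : latticePoint k z ∈ disc ε) : collapse ε k z = .star :=
  dif_pos h

lemma collapse_of_notMem {z : ℤ × ℤ} (h : latticePoint k z ∉ disc ε) :
    collapse ε k z = .plane z h :=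
  dif_neg h

lemma collapse_mem_planePart (z : ℤ × ℤ) : collapse ε k z ∈ planePart ε k := by
  by_cases h : latticePoint k z ∈ disc ε
  · exact Or.inl (collapse_of_mem h)
  · exact Or.inr ⟨z, h, collapse_of_notMem h⟩

lemma collapse_adj {z w : ℤ × ℤ} (h : (z.1 - w.1) ^ 2 + (z.2 - w.2) ^ 2 = 1)
    (hne : collapse ε k z ≠ collapse ε k w) :
    (graph ε k).Adj (collapse ε k z) (collapse ε k w) := by
  have h' : (w.1 - z.1) ^ 2 + (w.2 - z.2) ^ 2 = 1 := by rw [← h]; ring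
  by_cases hz : latticePoint k z ∈ disc ε <;> by_cases hw : latticePoint k w ∈ disc ε
  · exact absurd (by rw [collapse_of_mem hz, collapse_of_mem hw]) hne
  · rw [collapse_of_mem hz, collapse_of_notMem hw]
    exact (adj_plane_star hw hz h').symm
  · rw [collapse_of_notMem hz, collapse_of_mem hw]
    exact adj_plane_star hz hw h
  · rw [collapse_of_notMem hz, collapse_of_notMem hw]
    exact adj_plane hz hw h

/-- Lattice edges inside the disc contribute 0. Any other edge with distinct images has an endpoint
outside the disc, from which the edge in direction e is recovered; hence these edges inject into the
oriented edges of the planar part. -/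
lemma tsum_abs_sub_collapse_le {g : Vertex ε k → ℝ} {e : ℤ × ℤ} (he : e.1 ^ 2 + e.2 ^ 2 = 1)
    (hs : Summable fun d : {d : (graph ε k).Dart // d.fst ∈ planePart ε k ∧ d.snd ∈ planePart ε k}
      => |g d.1.fst - g d.1.snd|) :
    ∑' z, |g (collapse ε k (z + e)) - g (collapse ε k z)| ≤
      ∑' d : {d : (graph ε k).Dart // d.fst ∈ planePart ε k ∧ d.snd ∈ planePart ε k},
        |g d.1.fst - g d.1.snd| := by
  let A : Set (ℤ × ℤ) := {z | collapse ε k z ≠ collapse ε k (z + e)}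
  have hsupp : (Function.support fun z => |g (collapse ε k (z + e)) - g (collapse ε k z)|) ⊆ A := by
    intro z hz hA
    exact hz (by simp [hA])
  let ι : A → {d : (graph ε k).Dart // d.fst ∈ planePart ε k ∧ d.snd ∈ planePart ε k} := fun z =>
    ⟨⟨(collapse ε k z.1, collapse ε k (z.1 + e)), collapse_adj (by simpa using he) z.2⟩,
      collapse_mem_planePart _, collapse_mem_planePart _⟩
  have hι : Function.Injective ι := by
    rintro ⟨z, hz⟩ ⟨w, hw⟩ h
    have h1 : collapse ε k z = collapse ε k w := congrArg (fun d => d.1.fst) h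
    have h2 : collapse ε k (z + e) = collapse ε k (w + e) := congrArg (fun d => d.1.snd) h
    rw [Subtype.mk.injEq]
    by_cases hzd : latticePoint k z ∈ disc ε
    · have hze : latticePoint k (z + e) ∉ disc ε := fun h' =>
        hz (by rw [collapse_of_mem hzd, collapse_of_mem h'])
      have hwe : latticePoint k (w + e) ∉ disc ε := fun h' => by
        rw [collapse_of_notMem hze, collapse_of_mem h'] at h2
        cases h2
      rw [collapse_of_notMem hze, collapse_of_notMem hwe, Vertex.plane.injEq] at h2
      exact add_right_cancel h2
    · have hwd : latticePoint k w ∉ disc ε := fun h' => by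
        rw [collapse_of_notMem hzd, collapse_of_mem h'] at h1
        cases h1
      rwa [collapse_of_notMem hzd, collapse_of_notMem hwd, Vertex.plane.injEq] at h1
  rw [← tsum_subtype_eq_of_support_subset hsupp]
  refine Summable.tsum_le_tsum_of_inj ι hι (fun _ _ => abs_nonneg _) (fun z => ?_) ?_ hs
  · rw [abs_sub_comm]
  · refine (hs.comp_injective hι).congr fun z => ?_
    rw [abs_sub_comm]; rfl

lemma eq_of_sq_add_sq_eq_one {a b : ℤ} (h : a ^ 2 + b ^ 2 = 1) :
    (a, b) ∈ ({(1, 0), (-1, 0), (0, 1), (0, -1)} : Finset (ℤ × ℤ)) := by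
  have ha : a ≤ 1 := by nlinarith
  have ha' : -1 ≤ a := by nlinarith
  have hb : b ≤ 1 := by nlinarith
  have hb' : -1 ≤ b := by nlinarith
  interval_cases a <;> interval_cases b <;> simp_all

lemma degree_plane_le (z : ℤ × ℤ) (hz : latticePoint k z ∉ disc ε) :
    (degree ε k (.plane z hz) : ℝ) ≤ 4 := by
  classical
  have hsub : neighbors (.plane z hz : Vertex ε k) ⊆
      ({(1, 0), (-1, 0), (0, 1), (0, -1)} : Finset (ℤ × ℤ)).image
        fun e => collapse ε k (z - e) := by
    intro y hy
    rw [mem_neighbors] at hy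
    rw [Finset.mem_image]
    rcases y with _ | m | ⟨w, hw⟩
    · obtain ⟨w, hw, hd⟩ := hy
      refine ⟨z - w, eq_of_sq_add_sq_eq_one ((dist_latticePoint_eq_mesh_iff z w).1 hd), ?_⟩
      rw [sub_sub_cancel, collapse_of_mem hw]
    · exact absurd hy (by exact id)
    · refine ⟨z - w, eq_of_sq_add_sq_eq_one ((dist_latticePoint_eq_mesh_iff z w).1 hy.1), ?_⟩
      rw [sub_sub_cancel, collapse_of_notMem hw]
  rw [← card_neighbors]
  have h := (Finset.card_le_card hsub).trans Finset.card_image_le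
  exact_mod_cast h

/-- The lattice points of the closed disc. -/
noncomputable def discPoints (ε : ℝ) (k : ℕ) : Finset (ℤ × ℤ) := (finite_near k ε 0).toFinset

lemma mem_discPoints {z : ℤ × ℤ} : z ∈ discPoints ε k ↔ latticePoint k z ∈ disc ε := by
  simp [discPoints, disc]

lemma degree_star_le : (degree ε k .star : ℝ) ≤ 1 + 4 * (discPoints ε k).card := by
  classical
  have hsub : neighbors (.star : Vertex ε k) ⊆ insert (.line 1)
      ((discPoints ε k ×ˢ ({(1, 0), (-1, 0), (0, 1), (0, -1)} : Finset (ℤ × ℤ))).image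
        fun p => collapse ε k (p.1 + p.2)) := by
    intro y hy
    rw [mem_neighbors] at hy
    rw [Finset.mem_insert, Finset.mem_image]
    rcases y with _ | m | ⟨w, hw⟩
    · exact absurd hy (by exact id)
    · left; rw [show m = 1 from hy]
    · right
      obtain ⟨z, hz, hd⟩ := hy
      refine ⟨(z, w - z), Finset.mem_product.2 ⟨mem_discPoints.2 hz,
        eq_of_sq_add_sq_eq_one ((dist_latticePoint_eq_mesh_iff w z).1 hd)⟩, ?_⟩
      simp only [add_sub_cancel]
      rw [collapse_of_notMem hw]
  rw [← card_neighbors]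
  have h := (Finset.card_le_card hsub).trans (Finset.card_insert_le _ _)
  have h' := Finset.card_image_le (s := discPoints ε k ×ˢ
    ({(1, 0), (-1, 0), (0, 1), (0, -1)} : Finset (ℤ × ℤ))) (f := fun p => collapse ε k (p.1 + p.2))
  rw [Finset.card_product, show ({(1, 0), (-1, 0), (0, 1), (0, -1)} : Finset (ℤ × ℤ)).card = 4
    from rfl] at h'
  have h2 : (neighbors (.star : Vertex ε k)).card ≤ 1 + 4 * (discPoints ε k).card := by omega
  exact_mod_cast h2

/-- The lattice points on the nonnegative first axis already suffice. -/
lemma mul_two_pow_le_card_discPoints (hε : 0 ≤ ε) : ε * 2 ^ k ≤ (discPoints ε k).card := by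
  classical
  have hm := mesh_pos k
  have hmk := mesh_mul_two_pow k
  have hsub : (Finset.range (⌊ε * 2 ^ k⌋₊ + 1)).image (fun a : ℕ => ((a : ℤ), (0 : ℤ))) ⊆
      discPoints ε k := by
    intro z hz
    obtain ⟨a, ha, rfl⟩ := Finset.mem_image.1 hz
    rw [mem_discPoints, mem_disc_iff hε]
    have ha' : (a : ℝ) ≤ ε * 2 ^ k := by
      have := Nat.floor_le (show 0 ≤ ε * 2 ^ k by positivity)
      have h2 : (a : ℝ) ≤ ⌊ε * 2 ^ k⌋₊ := by exact_mod_cast Nat.lt_succ_iff.1 (Finset.mem_range.1 ha)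
      linarith
    have h3 : mesh k * a ≤ ε := by
      calc mesh k * a ≤ mesh k * (ε * 2 ^ k) := by gcongr
        _ = ε := by rw [mul_left_comm, hmk, mul_one]
    simp only [Int.cast_natCast, Int.cast_zero]
    rw [zero_pow two_ne_zero, add_zero, ← mul_pow]
    gcongr
  have h := Finset.card_le_card hsub
  rw [Finset.card_image_of_injective _ (fun a b h => by simpa using h), Finset.card_range] at h
  have h2 := (Nat.lt_floor_add_one (ε * 2 ^ k)).le
  exact h2.trans (by exact_mod_cast h)

/-- The lattice points that the projection maps to a given vertex. -/
noncomputable def fiber : Vertex ε k → Finset (ℤ × ℤ)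
  | .star => discPoints ε k
  | .line _ => ∅
  | .plane z _ => {z}

lemma collapse_of_mem_fiber {x : Vertex ε k} {z : ℤ × ℤ} (h : z ∈ fiber x) :
    collapse ε k z = x := by
  rcases x with _ | n | ⟨w, hw⟩
  · exact collapse_of_mem (mem_discPoints.1 h)
  · simp [fiber] at h
  · rw [fiber, Finset.mem_singleton] at h
    subst h
    exact collapse_of_notMem hw

/-- Compares m_k with the image of the measure 4^{-k} on the lattice. At `a*_k` the one-dimensional
term 2^{-k}/2 is absorbed because the disc has at least ε2^k points, which costs the factor 1/ε. -/
lemma mass_le_card_fiber (hε : 0 < ε) {x : Vertex ε k} (hx : x ∈ planePart ε k) :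
    mass ε k x ≤ (1 + 1 / ε) * mesh k ^ 2 * (fiber x).card := by
  have hm := mesh_pos k
  have hmk := mesh_mul_two_pow k
  rcases hx with rfl | ⟨z, hz, rfl⟩
  · have h1 := degree_star_le (ε := ε) (k := k)
    have h2 := mul_two_pow_le_card_discPoints (k := k) hε.le
    simp only [mass, fiber]
    set c : ℝ := ((discPoints ε k).card : ℝ)
    have h3 : mesh k ≤ 1 / ε * mesh k ^ 2 * c := by
      calc mesh k = 1 / ε * mesh k ^ 2 * (ε * 2 ^ k) := by
            have : 1 / ε * mesh k ^ 2 * (ε * 2 ^ k) = mesh k * (mesh k * 2 ^ k) := by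
              field_simp
            rw [this, hmk, mul_one]
        _ ≤ _ := by gcongr
    have h4 : mesh k ^ 2 / 4 * (degree ε k .star - 1) ≤ mesh k ^ 2 / 4 * (4 * c) := by
      gcongr; linarith
    linarith
  · have h1 := degree_plane_le (ε := ε) (k := k) z hz
    simp only [mass, fiber, Finset.card_singleton, Nat.cast_one, mul_one]
    have h3 : mesh k ^ 2 / 4 * degree ε k (.plane z hz) ≤ mesh k ^ 2 / 4 * 4 := by gcongr
    have h4 : 0 ≤ 1 / ε * mesh k ^ 2 := by positivity
    linarith

lemma summable_mul_card_fiber {g : Vertex ε k → ℝ} (hg : ∀ x, 0 ≤ g x)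
    (hs : Summable fun z => g (collapse ε k z)) :
    (Summable fun x => g x * (fiber x).card) ∧
      ∑' x, g x * (fiber x).card ≤ ∑' z, g (collapse ε k z) := by
  classical
  have h : ∀ S : Finset (Vertex ε k), ∑ x ∈ S, g x * (fiber x).card ≤
      ∑' z, g (collapse ε k z) := by
    intro S
    have h1 : ∑ x ∈ S, g x * (fiber x).card = ∑ z ∈ S.biUnion fiber, g (collapse ε k z) := by
      rw [Finset.sum_biUnion]
      · refine Finset.sum_congr rfl fun x _ => ?_
        rw [Finset.sum_congr rfl fun z hz => by rw [collapse_of_mem_fiber hz], Finset.sum_const,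
          nsmul_eq_mul, mul_comm]
      · intro x _ y _ hxy
        rw [Function.onFun, Finset.disjoint_left]
        intro z hzx hzy
        exact hxy ((collapse_of_mem_fiber hzx).symm.trans (collapse_of_mem_fiber hzy))
    rw [h1]
    exact hs.sum_le_tsum _ fun z _ => hg _
  have h0 : ∀ x, 0 ≤ g x * (fiber x).card := fun x => mul_nonneg (hg x) (Nat.cast_nonneg _)
  exact ⟨summable_of_sum_le h0 h, Real.tsum_le_of_sum_le h0 h⟩

/-! ### The Nash inequality -/

/-- Cauchy–Schwarz on |f(x)² - f(y)²| = |f(x) - f(y)||f(x) + f(y)|: the first factor gives the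
energy, the second the `L²` norm, and each conversion to conductance-weighted sums costs 1/κ. -/
lemma tsum_abs_sub_sq_le (f : L2 ε k) (p : (graph ε k).Dart → Prop) {κ : ℝ} (hκ : 0 < κ)
    (hp : ∀ e, p e → κ ≤ conductance e.fst e.snd) :
    (Summable fun e : {e // p e} => |f e.1.fst ^ 2 - f e.1.snd ^ 2|) ∧
      (∑' e : {e // p e}, |f e.1.fst ^ 2 - f e.1.snd ^ 2|) ^ 2 ≤
        8 * (2 ^ k) ^ 2 / κ ^ 2 * energy ε k f f * ‖f‖ ^ 2 := by
  have hg := summable_conductance_grad_mul f f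
  obtain ⟨ha, ha'⟩ := tsum_conductance_add_sq f
  have hsub : ∀ {F : (graph ε k).Dart → ℝ}, (∀ e, 0 ≤ F e) →
      Summable (fun e => conductance e.fst e.snd * F e) →
      (Summable fun e : {e // p e} => F e.1) ∧
        ∑' e : {e // p e}, F e.1 ≤ κ⁻¹ * ∑' e, conductance e.fst e.snd * F e := by
    intro F hF hs
    have hs' := (hs.mul_left κ⁻¹).comp_injective (Subtype.val_injective (p := p))
    have hle : ∀ e : {e // p e}, F e.1 ≤ κ⁻¹ * (conductance e.1.fst e.1.snd * F e.1) := by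
      intro e
      rw [← div_eq_inv_mul, le_div_iff₀ hκ, mul_comm]
      exact mul_le_mul_of_nonneg_right (hp e.1 e.2) (hF _)
    have h0 : ∀ e, 0 ≤ κ⁻¹ * (conductance e.fst e.snd * F e) := fun e =>
      mul_nonneg (inv_pos.2 hκ).le (mul_nonneg (conductance_pos _ _).le (hF e))
    have hsF := Summable.of_nonneg_of_le (fun e : {e // p e} => hF e.1) hle hs'
    refine ⟨hsF, (hsF.tsum_le_tsum hle hs').trans ?_⟩
    rw [← tsum_mul_left]
    exact (hs.mul_left κ⁻¹).tsum_subtype_le _ {e | p e} h0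
  obtain ⟨h1, h2⟩ := hsub (F := fun e => (f e.fst - f e.snd) * (f e.fst - f e.snd))
    (fun e => mul_self_nonneg _) hg
  obtain ⟨h3, h4⟩ := hsub (F := fun e => f e.fst ^ 2 + f e.snd ^ 2)
    (fun e => by positivity) ha
  have hE := energy_eq_tsum f f
  have hE0 := energy_nonneg ε k f
  have h5 : (Summable fun e : {e // p e} => (f e.1.fst + f e.1.snd) ^ 2) ∧
      ∑' e : {e // p e}, (f e.1.fst + f e.1.snd) ^ 2 ≤ κ⁻¹ * (4 * (2 ^ k) ^ 2 * ‖f‖ ^ 2) := by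
    have hle : ∀ e : {e // p e}, (f e.1.fst + f e.1.snd) ^ 2 ≤
        2 * (f e.1.fst ^ 2 + f e.1.snd ^ 2) := fun e => by
      nlinarith [sq_nonneg (f e.1.fst - f e.1.snd)]
    have hs := Summable.of_nonneg_of_le (fun e => sq_nonneg _) hle (h3.mul_left 2)
    refine ⟨hs, (hs.tsum_le_tsum hle (h3.mul_left 2)).trans ?_⟩
    rw [tsum_mul_left]
    rw [ha'] at h4
    linarith
  have h6 : ∑' e : {e // p e}, (f e.1.fst - f e.1.snd) ^ 2 ≤ κ⁻¹ * (2 * energy ε k f f) := by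
    simp only [sq]
    rw [hE]
    linarith
  simp only [← sq] at h1
  obtain ⟨h7, h8⟩ := tsum_mul_sq_le
    (u := fun e : {e // p e} => |f e.1.fst - f e.1.snd|)
    (v := fun e : {e // p e} => |f e.1.fst + f e.1.snd|)
    (by simpa only [sq_abs] using h1) (by simpa only [sq_abs] using h5.1)
  have h9 : ∀ e : {e // p e}, |f e.1.fst ^ 2 - f e.1.snd ^ 2| =
      |f e.1.fst - f e.1.snd| * |f e.1.fst + f e.1.snd| := fun e => by
    rw [← abs_mul]; congr 1; ring
  simp only [h9]
  refine ⟨h7, h8.trans ?_⟩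
  simp only [sq_abs]
  calc _ ≤ (κ⁻¹ * (2 * energy ε k f f)) * (κ⁻¹ * (4 * (2 ^ k) ^ 2 * ‖f‖ ^ 2)) :=
        mul_le_mul h6 h5.2 (tsum_nonneg fun _ => sq_nonneg _) (by positivity)
    _ = _ := by field_simp; ring

lemma summable_sq (f : L2 ε k) : Summable fun x => f x ^ 2 := by
  refine Summable.of_nonneg_of_le (fun x => sq_nonneg _) (fun x => ?_)
    ((summable_sq_mass f).mul_left (4 * (2 ^ k) ^ 2))
  have h := (one_le_degree ε k x).trans (degree_le_mass ε k x)
  calc f x ^ 2 = f x ^ 2 * 1 := (mul_one _).symm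
    _ ≤ f x ^ 2 * (4 * (2 ^ k) ^ 2 * mass ε k x) := by gcongr
    _ = _ := by ring

lemma summable_collapse {g : Vertex ε k → ℝ} (hg : Summable g) :
    Summable fun z => g (collapse ε k z) := by
  rw [← (discPoints ε k).summable_compl_iff]
  have hmem : ∀ z : {z // z ∉ discPoints ε k}, latticePoint k z.1 ∉ disc ε :=
    fun z h => z.2 (mem_discPoints.2 h)
  have hinj : Function.Injective fun z : {z // z ∉ discPoints ε k} => collapse ε k z.1 := by
    intro z w h
    simp only [collapse_of_notMem (hmem z), collapse_of_notMem (hmem w), Vertex.plane.injEq] at h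
    exact Subtype.ext h
  exact hg.comp_injective hinj

/-- Gagliardo–Nirenberg for f² pulled back to ℤ²; both directional variations are bounded by the
same sum over planar edges. Here κ = 1/4. -/
lemma tsum_pow_four_collapse_le (f : L2 ε k) :
    (Summable fun z => f (collapse ε k z) ^ 4) ∧
      ∑' z, f (collapse ε k z) ^ 4 ≤ 128 * (2 ^ k) ^ 2 * energy ε k f f * ‖f‖ ^ 2 := by
  obtain ⟨h1, h2⟩ := tsum_abs_sub_sq_le f
    (fun d => d.fst ∈ planePart ε k ∧ d.snd ∈ planePart ε k) (κ := 1 / 4) (by norm_num)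
    (fun e he => by
      rcases mem_parts_of_adj e.adj with h | h
      · exact h.2.2.1.ge
      · exact absurd he h.2.2.2)
  obtain ⟨h3, h4⟩ := tsum_sq_le_mul_tsum_abs_sub (summable_collapse (summable_sq f))
  have h5 := tsum_abs_sub_collapse_le (g := fun x => f x ^ 2) (e := (1, 0)) (by norm_num) h1
  have h6 := tsum_abs_sub_collapse_le (g := fun x => f x ^ 2) (e := (0, 1)) (by norm_num) h1
  simp only [← pow_mul] at h3 h4
  refine ⟨h3, h4.trans ((mul_le_mul h5 h6 (tsum_nonneg fun _ => abs_nonneg _)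
    (tsum_nonneg fun _ => abs_nonneg _)).trans ?_)⟩
  rw [← sq]
  refine h2.trans_eq ?_
  ring

/-- The point of the half-line `i` steps further out than `n`. -/
def lineFrom (n : ℕ+) (i : ℕ) : Vertex ε k := .line ⟨n + i, Nat.add_pos_left n.pos i⟩

lemma lineFrom_zero (n : ℕ+) : lineFrom n 0 = (.line n : Vertex ε k) := rfl

lemma lineFrom_injective (n : ℕ+) : Function.Injective (lineFrom n : ℕ → Vertex ε k) := by
  intro i j h
  have := congrArg PNat.val (Vertex.line.inj h)
  exact Nat.add_left_cancel this

lemma lineFrom_adj (n : ℕ+) (i : ℕ) :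
    (graph ε k).Adj (lineFrom n (i + 1)) (lineFrom n i) :=
  show _ ∨ _ from Or.inr (PNat.eq (Nat.add_assoc n i 1))

lemma abs_line_le_tsum_abs_sub {g : Vertex ε k → ℝ} (hg : Summable g) (n : ℕ+)
    (hs : Summable fun d : {d : (graph ε k).Dart // d.fst ∈ linePart ε k ∧ d.snd ∈ linePart ε k}
      => |g d.1.fst - g d.1.snd|) :
    |g (.line n)| ≤
      ∑' d : {d : (graph ε k).Dart // d.fst ∈ linePart ε k ∧ d.snd ∈ linePart ε k},
        |g d.1.fst - g d.1.snd| := by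
  let ι : ℕ → {d : (graph ε k).Dart // d.fst ∈ linePart ε k ∧ d.snd ∈ linePart ε k} := fun i =>
    ⟨⟨(lineFrom n (i + 1), lineFrom n i), lineFrom_adj n i⟩, Or.inr ⟨_, rfl⟩, Or.inr ⟨_, rfl⟩⟩
  have hι : Function.Injective ι := fun i j h =>
    lineFrom_injective n (congrArg (fun d => d.1.snd) h)
  have h : |g (lineFrom n 0)| ≤ ∑' i, |g (lineFrom n (i + 1)) - g (lineFrom n i)| :=
    abs_zero_le_tsum_abs_sub (hg.comp_injective (lineFrom_injective n))
  have hι' : ∀ i, |g (lineFrom n (i + 1)) - g (lineFrom n i)| =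
      |g (ι i).1.fst - g (ι i).1.snd| := fun i => rfl
  simp only [hι'] at h
  rw [← lineFrom_zero]
  exact h.trans (tsum_comp_le_tsum_of_inj hs (fun _ => abs_nonneg _) hι)

/-- Telescoping f² outward along the half-line. The conductance κ = 2^k/2 cancels the 4^k, leaving a
bound free of k. -/
lemma line_pow_four_le (f : L2 ε k) (n : ℕ+) :
    f (.line n) ^ 4 ≤ 32 * energy ε k f f * ‖f‖ ^ 2 := by
  obtain ⟨h1, h2⟩ := tsum_abs_sub_sq_le f
    (fun d => d.fst ∈ linePart ε k ∧ d.snd ∈ linePart ε k) (κ := 2 ^ k / 2) (by positivity)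
    (fun e he => by
      rcases mem_parts_of_adj e.adj with h | h
      · exact absurd he h.2.2.2
      · exact h.2.2.1.ge)
  have h3 := abs_line_le_tsum_abs_sub (g := fun x => f x ^ 2) (summable_sq f) n h1
  have h4 := (pow_le_pow_left₀ (abs_nonneg _) h3 2).trans h2
  have h5 : 8 * (2 ^ k : ℝ) ^ 2 / (2 ^ k / 2) ^ 2 = 32 := by
    field_simp
    norm_num
  rw [sq_abs, ← pow_mul, h5] at h4
  exact h4

lemma sq_le_mul_add {a l : ℝ} (ha : 0 ≤ a) (hl : 0 < l) : a ^ 2 ≤ l * a + a ^ 4 / l ^ 2 := by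
  rcases le_or_gt a l with h | h
  · have : 0 ≤ a ^ 4 / l ^ 2 := by positivity
    nlinarith
  · have : a ^ 2 ≤ a ^ 4 / l ^ 2 := by
      rw [le_div_iff₀ (by positivity)]
      calc a ^ 2 * l ^ 2 ≤ a ^ 2 * a ^ 2 := by gcongr
        _ = a ^ 4 := by ring
    have : 0 ≤ l * a := by positivity
    linarith

/-- In the plane f² ≤ lf + f⁴/l²; on the half-line f ≤ B. As f has mass at most 1, the linear terms
contribute at most l + B, and the quartic term is the collapsed lattice sum. -/
lemma norm_sq_le_of_isSubDensity (hε : 0 < ε) {f : L2 ε k} (hf : IsSubDensity 1 f) {l B : ℝ}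
    (hl : 0 < l) (hB : 0 ≤ B) (hB4 : 32 * energy ε k f f * ‖f‖ ^ 2 ≤ B ^ 4) :
    ‖f‖ ^ 2 ≤ l + B + 128 * (1 + 1 / ε) * energy ε k f f * ‖f‖ ^ 2 / l ^ 2 := by
  have hm := mesh_pos k
  have h0 : ∀ x, 0 ≤ f x * mass ε k x := fun x => mul_nonneg (hf.1 x) (mass_pos ε k x).le
  have h1 := summable_of_sum_le h0 hf.2
  have h2 := Real.tsum_le_of_sum_le h0 hf.2
  obtain ⟨h3, h4⟩ := tsum_pow_four_collapse_le f
  obtain ⟨h5, h6⟩ := summable_mul_card_fiber (g := fun x => f x ^ 4) (fun x => by positivity) h3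
  set C : ℝ := (1 + 1 / ε) * mesh k ^ 2 with hC
  have hC0 : 0 ≤ C := by positivity
  have hle : ∀ x, f x ^ 2 * mass ε k x ≤ (l + B) * (f x * mass ε k x) +
      C / l ^ 2 * (f x ^ 4 * (fiber x).card) := by
    intro x
    have hx := h0 x
    have hmx := (mass_pos ε k x).le
    have hplane : x ∈ planePart ε k → f x ^ 2 * mass ε k x ≤ (l + B) * (f x * mass ε k x) +
      C / l ^ 2 * (f x ^ 4 * (fiber x).card) := by
      intro hxp
      have h7 := mul_le_mul_of_nonneg_right (sq_le_mul_add (hf.1 x) hl) hmx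
      have h8 : f x ^ 4 / l ^ 2 * mass ε k x ≤ f x ^ 4 / l ^ 2 * (C * (fiber x).card) := by
        gcongr
        exact mass_le_card_fiber hε hxp
      have h9 : 0 ≤ B * (f x * mass ε k x) := by positivity
      calc _ ≤ _ := h7
        _ = l * (f x * mass ε k x) + f x ^ 4 / l ^ 2 * mass ε k x := by ring
        _ ≤ (l + B) * (f x * mass ε k x) + f x ^ 4 / l ^ 2 * (C * (fiber x).card) := by linarith
        _ = _ := by ring
    rcases x with _ | n | ⟨z, hz⟩
    · exact hplane (Or.inl rfl)
    · have h7 : f (.line n) ≤ B :=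
        le_of_pow_le_pow_left₀ four_ne_zero hB ((line_pow_four_le f n).trans hB4)
      have h8 : 0 ≤ l * (f (.line n) * mass ε k (.line n)) := by positivity
      have h9 := mul_le_mul_of_nonneg_right h7 hx
      simp only [fiber, Finset.card_empty, Nat.cast_zero, mul_zero, add_zero]
      linarith
    · exact hplane (Or.inr ⟨z, hz, rfl⟩)
  have hs := (h1.mul_left (l + B)).add (h5.mul_left (C / l ^ 2))
  have h := (summable_sq_mass f).tsum_le_tsum hle hs
  rw [(h1.mul_left (l + B)).tsum_add (h5.mul_left (C / l ^ 2)), tsum_mul_left, tsum_mul_left,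
    ← norm_sq_eq_tsum] at h
  have h10 : (l + B) * ∑' x, f x * mass ε k x ≤ (l + B) * 1 := by gcongr
  have h11 : C / l ^ 2 * ∑' x, f x ^ 4 * (fiber x).card ≤
      C / l ^ 2 * (128 * (2 ^ k) ^ 2 * energy ε k f f * ‖f‖ ^ 2) := by
    gcongr
    exact h6.trans h4
  have h12 : C / l ^ 2 * (128 * (2 ^ k) ^ 2 * energy ε k f f * ‖f‖ ^ 2) =
      128 * (1 + 1 / ε) * energy ε k f f * ‖f‖ ^ 2 / l ^ 2 := by
    have : C / l ^ 2 * (128 * (2 ^ k) ^ 2 * energy ε k f f * ‖f‖ ^ 2) =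
      (mesh k * 2 ^ k) ^ 2 * (128 * (1 + 1 / ε) * energy ε k f f * ‖f‖ ^ 2 / l ^ 2) := by
      rw [hC]; ring
    rw [this, mesh_mul_two_pow, one_pow, one_mul]
  linarith

lemma nash (hε : 0 < ε) {f : L2 ε k} (hf : IsSubDensity 1 f) :
    ‖f‖ ^ 4 ≤ 8192 * (1 + 1 / ε) * energy ε k f f ∨ ‖f‖ ^ 6 ≤ 8192 * energy ε k f f := by
  have hE := energy_nonneg ε k f
  rcases eq_or_ne (‖f‖ ^ 2) 0 with hN0 | hN0
  · left
    have : ‖f‖ ^ 4 = (‖f‖ ^ 2) ^ 2 := by ring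
    rw [this, hN0, zero_pow two_ne_zero]
    exact mul_nonneg (by positivity) hE
  have hN : 0 < ‖f‖ ^ 2 := lt_of_le_of_ne (sq_nonneg _) hN0.symm
  rw [show ‖f‖ ^ 4 = (‖f‖ ^ 2) ^ 2 by ring, show ‖f‖ ^ 6 = (‖f‖ ^ 2) ^ 3 by ring]
  have key := fun {l B : ℝ} => norm_sq_le_of_isSubDensity hε hf (l := l) (B := B)
  set N := ‖f‖ ^ 2
  set E := energy ε k f f
  by_contra! hcon
  obtain ⟨hc1, hc2⟩ := hcon
  -- If both alternatives fail, 32ℰN < (N/4)⁴, as 8192 = 32·4⁴, so B = N/4 is admissible; and the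
  -- quartic term is below N/2, so N < N/4 + N/4 + N/2.
  have h := key (l := N / 4) (B := N / 4) (by positivity) (by positivity) (by
    have : N ^ 3 * N = N ^ 4 := by ring
    nlinarith)
  have h2 : 128 * (1 + 1 / ε) * E * N / (N / 4) ^ 2 < N / 2 := by
    rw [div_lt_iff₀ (by positivity)]
    nlinarith
  linarith

end VaryingDim

/-! ### Assembly of the heat kernel bound -/

theorem proposition3p3 (ε : ℝ) (hε : 0 < ε) (hε' : ε < 1 / 64) (k₀ : ℕ)
    (hk₀ : ∀ k : ℕ, k₀ ≤ k → VaryingDim.mesh k < ε / 4) :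
    ∃ C₂ : ℝ, 0 < C₂ ∧ ∀ k : ℕ, k₀ ≤ k → ∀ α : ℝ, α ≤ 2 ^ ((k : ℤ) - 1) →
      ∀ t : ℝ, 0 < t → ∀ x y : VaryingDim.Vertex ε k,
        VaryingDim.heatKernel ε k t x y ≤
          C₂ * max (1 / t) (1 / √t) *
            Real.exp (-α * VaryingDim.graphDist ε k x y + 2 * t * α ^ 2) := by
  set K : ℝ := 8192 * (1 + 1 / ε) with hK
  have hKpos : 8192 ≤ K := by
    have : 0 < 1 / ε := by positivity
    linarith
  have hK0 : 0 < K := by linarith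
  refine ⟨32 * K, by positivity, fun k _ α hα t ht x y => ?_⟩
  refine VaryingDim.heatKernel_le_of_diag hε.le (fun x s hs => ?_) (by linarith) ?_ ht x y
  -- With c = 2/K both Nash alternatives take the required form, and 2/c = K is the diagonal
  -- constant.
  · have h := VaryingDim.norm_sq_semigroup_le (ε := ε) (k := k) (c := 2 / K) (by positivity)
      (by rw [div_le_iff₀ hK0]; linarith) (fun f hf => ?_) x hs
    · rwa [div_div_cancel₀ two_ne_zero] at h
    · have hE := VaryingDim.energy_nonneg ε k f
      rw [div_mul_eq_mul_div, div_mul_eq_mul_div, div_le_iff₀ hK0, div_le_iff₀ hK0]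
      rcases VaryingDim.nash hε hf with h | h
      · left; linarith
      · right; nlinarith
  · rwa [zpow_sub₀ two_ne_zero, zpow_natCast, zpow_one] at hα
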